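/- Let $\mathcal M_\delta$ be the space of locally finite point measures on $\mathbb R^d$, i.e. the Radon measures $\mu=\sum_{i\in I}\delta_{x_i}$ with $I$ finite or countable. For Borel $U\subset\mathbb R^d$ let $\mathcal F_U$ be the $\sigma$-algebra on $\mathcal M_\delta$ generated by the maps $\mu\mapsto\mu(V)$, $V\subset U$ Borel, and put $\mathcal F=\mathcal F_{\mathbb R^d}$. Let $\rho>0$, let $\mathbb P_\rho$ be the law on $(\mathcal M_\delta,\mathcal F)$ of the Poisson point process on $\mathbb R^d$ of density $\rho$, and let $\mathbb E_\rho$ be its expectation. Write $Q_s=[-\frac s2,\frac s2]^d$. For $h\in\mathbb R^d$ let $\tau_h\mu$ be the image of $\mu$ under $x\mapsto x+h$, and for $f:\mathcal M_\delta\to\mathbb R$ put $\tau_hf(\mu)=f(\tau_{-h}\mu)$. Let $C_c^\infty$ be the set of bounded functions $f:\mathcal M_\delta\to\mathbb R$ that are $\mathcal F_V$-measurable for some compact $V\subset\mathbb R^d$ and for which, for every $N\in\mathbb N$, the function $(x_1,\dots,x_N)\mapsto f(\sum_{i=1}^N\delta_{x_i})$ is infinitely differentiable on $(\mathbb R^d)^N$.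 For such $f$ and $x\in\operatorname{supp}\mu$ let $\nabla f(\mu,x)\in\mathbb R^d$ be the vector with coordinates $\lim_{\eta\to0}\frac1\eta\bigl(f(\mu-\delta_x+\delta_{x+\eta\mathbf e_j})-f(\mu)\bigr)$, $1\le j\le d$. Let $H^1_0$ be the completion of $\{f\in C_c^\infty:\|f\|_{H^1}<\infty\}$ for the norm $\|f\|_{H^1}=\bigl(\mathbb E_\rho[f^2]+\mathbb E_\rho[\int_{\mathbb R^d}|\nabla f(\mu,x)|^2\,d\mu(x)]\bigr)^{1/2}$. An element $f$ of $H^1_0$ has a gradient $\nabla f$, namely the limit of $\nabla f_n$ in the $L^2$ space of the measure $d\mu(x)\,d\mathbb P_\rho(\mu)$ along a sequence $f_n\in C_c^\infty$ that converges to $f$ in $H^1_0$. For Borel $U\subset\mathbb R^d$ put $\mathcal E_U(f)=\mathbb E_\rho\bigl[\int_U|\nabla f(\mu,x)|^2\,d\mu(x)\bigr]$. **Proposition (Perturbation).** There is a constant $C(d)\in(0,\infty)$, depending only on $d$, such that the following holds for every $\rho>0$. Let $u\in C_c^\infty$ be $\mathcal F_{Q_{l_u}}$-measurable, where $l_u\ge0$,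 let $k\ge0$ and $l_k=l_u+2k$. Then for every $h\in\mathbb R^d$ with $|h|\le k$ and every $g\ge0$ with $\mathbb E_\rho[g]=1$ and $\sqrt g\in H^1_0$, the function $g\,(u-\tau_hu)$ is integrable and $$\bigl(\mathbb E_\rho[g\,(u-\tau_hu)]\bigr)^2\le C(d)\,\bigl(l_k\|u\|_{L^\infty}\bigr)^2\,\mathcal E_{Q_{l_k}}(\sqrt g),$$ where $\|u\|_{L^\infty}$ is the essential supremum of $|u|$ under $\mathbb P_\rho$. -/

import Mathlib

open MeasureTheory Filter Topology
open scoped ENNReal NNReal ContDiff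

namespace PoissonConfig

/-- The Euclidean space of dimension `d`. -/
abbrev Space (d : ℕ) := EuclideanSpace ℝ (Fin d)

/-- The closed cube of edge length `s` centred at the origin. -/
def cube (d : ℕ) (s : ℝ) : Set (Space d) := {x | ∀ i, x i ∈ Set.Icc (-(s / 2)) (s / 2)}

/-- A point measure: a locally finite (i.e. Radon) measure on `ℝᵈ` that is a finite or countable
sum of Dirac masses. Multiple points are allowed. -/
def IsPointMeasure {d : ℕ} (μ : Measure (Space d)) : Prop :=
  IsLocallyFiniteMeasure μ ∧
    ∃ (ι : Type) (_ : Countable ι) (p : ι → Space d), μ = Measure.sum fun i => Measure.dirac (p i)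

/-- The continuum configuration space: all locally finite point measures on `ℝᵈ`. -/
def Config (d : ℕ) : Type := {μ : Measure (Space d) // IsPointMeasure μ}

/-- The `σ`-algebra of the observables in `U`: the smallest one for which `μ ↦ μ V` is measurable
for every Borel set `V ⊆ U`. -/
@[reducible] def sigmaAlg {d : ℕ} (U : Set (Space d)) : MeasurableSpace (Config d) :=
  ⨆ (V : Set (Space d)) (_ : MeasurableSet V) (_ : V ⊆ U),
    MeasurableSpace.comap (fun μ : Config d => μ.1 V) inferInstance

/-- The configuration space carries the `σ`-algebra generated by all `μ ↦ μ V`, `V` Borel. -/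
instance instMeasurableSpaceConfig {d : ℕ} : MeasurableSpace (Config d) := sigmaAlg Set.univ

theorem IsPointMeasure.add {d : ℕ} {μ ν : Measure (Space d)} (hμ : IsPointMeasure μ)
    (hν : IsPointMeasure ν) : IsPointMeasure (μ + ν) := by
  obtain ⟨h1, ι, _, p, rfl⟩ := hμ
  obtain ⟨h2, κ, _, q, rfl⟩ := hν
  refine ⟨⟨fun x => ?_⟩, ι ⊕ κ, inferInstance, Sum.elim p q, ?_⟩
  · obtain ⟨s, hs, hs'⟩ := h1.finiteAtNhds x
    obtain ⟨t, ht, ht'⟩ := h2.finiteAtNhds x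
    refine ⟨s ∩ t, inter_mem hs ht, ?_⟩
    rw [Measure.add_apply]
    exact ENNReal.add_lt_top.2 ⟨(measure_mono Set.inter_subset_left).trans_lt hs',
      (measure_mono Set.inter_subset_right).trans_lt ht'⟩
  · ext s hs
    rw [Measure.add_apply, Measure.sum_apply _ hs, Measure.sum_apply _ hs, Measure.sum_apply _ hs,
      ENNReal.summable.tsum_sum (f := fun i => Measure.dirac (Sum.elim p q i) s) ENNReal.summable]
    rfl

theorem IsPointMeasure.sum_dirac {d N : ℕ} (x : Fin N → Space d) :
    IsPointMeasure (∑ i, Measure.dirac (x i)) := by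
  refine ⟨inferInstance, Fin N, inferInstance, x, ?_⟩
  rw [Measure.sum_fintype]

theorem IsPointMeasure.dirac {d : ℕ} (y : Space d) : IsPointMeasure (Measure.dirac y) := by
  simpa using IsPointMeasure.sum_dirac (fun _ : Fin 1 => y)

theorem IsPointMeasure.translate {d : ℕ} {μ : Measure (Space d)} (hμ : IsPointMeasure μ)
    (h : Space d) : IsPointMeasure (μ.map fun x => x + h) := by
  obtain ⟨h1, ι, _, p, hp⟩ := hμ
  refine ⟨⟨fun x => ?_⟩, ι, inferInstance, fun i => p i + h, ?_⟩
  · obtain ⟨s, hs, hs'⟩ := h1.finiteAtNhds (x - h)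
    refine ⟨(fun y => y - h) ⁻¹' s, ?_, ?_⟩
    · exact (continuous_id.sub continuous_const).continuousAt.preimage_mem_nhds hs
    · have : MeasurableEmbedding (fun x : Space d => x + h) := measurableEmbedding_addRight h
      rw [this.map_apply]
      simpa [Set.preimage_preimage] using hs'
  · subst hp
    rw [Measure.map_sum (by fun_prop)]
    congr 1
    ext1 i
    exact Measure.map_dirac' (by fun_prop) (p i)

theorem IsPointMeasure.erase {d : ℕ} {μ : Measure (Space d)} (hμ : IsPointMeasure μ)
    (x : Space d) : IsPointMeasure (μ.restrict {x}ᶜ + (μ {x} - 1) • Measure.dirac x) := by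
  obtain ⟨h1, ι, _, p, hp⟩ := hμ
  refine IsPointMeasure.add ⟨inferInstance, {i // p i ≠ x}, inferInstance, fun i => p i, ?_⟩ ?_
  · ext s hs
    rw [hp, Measure.restrict_apply hs, Measure.sum_apply _ (hs.inter (measurableSet_singleton x).compl),
      Measure.sum_apply _ hs, ← tsum_subtype_eq_of_support_subset (s := {i | p i ≠ x})]
    · refine tsum_congr fun i => ?_
      have hi : p i ≠ x := i.2
      rw [Measure.dirac_apply' _ (hs.inter (measurableSet_singleton x).compl),
        Measure.dirac_apply' _ hs]
      by_cases h : p i ∈ s <;> simp [Set.indicator, h, hi]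
    · intro i hi h
      apply hi
      show Measure.dirac (p i) (s ∩ {x}ᶜ) = 0
      rw [Measure.dirac_apply' _ (hs.inter (measurableSet_singleton x).compl)]
      simp [h]
  · have hx : μ {x} = ({i | p i = x} : Set ι).encard := by
      rw [hp, Measure.sum_apply _ (measurableSet_singleton x), ← ENNReal.tsum_set_one,
        tsum_subtype {i | p i = x} (fun _ => (1 : ℝ≥0∞))]
      refine tsum_congr fun i => ?_
      rw [Measure.dirac_apply' _ (measurableSet_singleton x)]
      simp [Set.indicator]
    have hfin : μ {x} ≠ ⊤ := isCompact_singleton.measure_lt_top.ne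
    have hf : ({i | p i = x} : Set ι).Finite := by
      rw [← Set.encard_ne_top_iff]
      intro h
      rw [hx, h] at hfin
      simp at hfin
    obtain ⟨n, hn⟩ : ∃ n : ℕ, μ {x} - 1 = n := by
      refine ⟨({i | p i = x} : Set ι).ncard - 1, ?_⟩
      rw [hx, ← hf.cast_ncard_eq]
      push_cast
      simp
    have := IsPointMeasure.sum_dirac (fun _ : Fin n => x)
    rw [hn]
    convert this using 1
    simp [Nat.cast_smul_eq_nsmul]

/-- The finite configuration `∑ᵢ δ_{xᵢ}`. -/
noncomputable def ofPoints {d N : ℕ} (x : Fin N → Space d) : Config d :=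
  ⟨∑ i, Measure.dirac (x i), IsPointMeasure.sum_dirac x⟩

/-- The transport of a configuration: every particle is shifted by `h`. -/
noncomputable def translate {d : ℕ} (h : Space d) (μ : Config d) : Config d :=
  ⟨μ.1.map fun x => x + h, μ.2.translate h⟩

/-- The transport of a function of the configuration, `(τ_h f)(μ) = f (τ_{-h} μ)`. -/
noncomputable def translateFun {d : ℕ} (h : Space d) (f : Config d → ℝ) : Config d → ℝ :=
  fun μ => f (translate (-h) μ)

/-- The configuration `μ - δ_x + δ_y`, where one particle of `μ` at `x` is moved to `y`
(meaningful when `μ` has a particle at `x`). -/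
noncomputable def move {d : ℕ} (μ : Config d) (x y : Space d) : Config d :=
  ⟨(μ.1.restrict {x}ᶜ + (μ.1 {x} - 1) • Measure.dirac x) + Measure.dirac y,
    (μ.2.erase x).add (IsPointMeasure.dirac y)⟩

/-- The gradient of `f` with respect to the position of a particle of `μ` at `x`; its `k`-th
coordinate is the derivative at `h = 0` of `h ↦ f (μ - δ_x + δ_{x + h eₖ})`. -/
noncomputable def grad {d : ℕ} (f : Config d → ℝ) (μ : Config d) (x : Space d) : Space d :=
  WithLp.toLp 2 fun k =>
    deriv (fun h : ℝ => f (move μ x (x + h • EuclideanSpace.single k (1 : ℝ)))) 0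

/-- `P` is the law of the Poisson point process on `ℝᵈ` of density `ρ`, given by its finite-volume
laws: for each bounded Borel set `U`, the number of particles in `U` is Poisson with parameter
`ρ|U|`, and given that there are `N` of them they are independent and uniform in `U`. Thus the
weight `e^{-ρ|U|} (ρ|U|)^N / N!` and the average over `U^N` combine to
`e^{-ρ|U|} ρ^N / N!` times the integral over `U^N`. -/
def IsPoisson {d : ℕ} (ρ : ℝ) (P : Measure (Config d)) : Prop :=
  ∀ U : Set (Space d), MeasurableSet U → Bornology.IsBounded U →
    ∀ F : Config d → ℝ≥0∞, Measurable[sigmaAlg U] F →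
      ∫⁻ μ, F μ ∂P =
        ∑' N : ℕ, ENNReal.ofReal (Real.exp (-(ρ * (volume U).toReal)) * ρ ^ N / N.factorial) *
          ∫⁻ x in Set.univ.pi fun _ : Fin N => U, F (ofPoints x)

/-- The class `C_c^∞` of smooth local functions on the configuration space: bounded functions
that depend only on the configuration in some compact set and that are, for each `N`, smooth
functions of the positions of the particles on the set of configurations of `N` particles. -/
structure IsSmoothLocal {d : ℕ} (f : Config d → ℝ) : Prop where
  local_meas : ∃ V : Set (Space d), IsCompact V ∧ Measurable[sigmaAlg V] f
  smooth : ∀ N : ℕ, ContDiff ℝ ∞ fun x : Fin N → Space d => f (ofPoints x)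
  bounded : ∃ M : ℝ, ∀ μ, |f μ| ≤ M

/-- `E_ρ[∫_U |G(μ, x)|² dμ(x)]` for a field `G`. -/
noncomputable def energyOn {d : ℕ} (P : Measure (Config d)) (U : Set (Space d))
    (G : Config d → Space d → Space d) : ℝ≥0∞ :=
  ∫⁻ μ, ∫⁻ x in U, ‖G μ x‖ₑ ^ 2 ∂μ.1 ∂P

/-- `f` belongs to `H¹₀`, with gradient `G`. The space `H¹₀` is the completion of the functions of
class `C_c^∞` with finite `H¹` norm, for the norm
`(E_ρ[f²] + E_ρ[∫ |∇f|² dμ])^{1/2}`; equivalently it is the closure of the set of pairs `(f, ∇f)`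
in the product of `L²(P)` and the `L²` space of fields. -/
structure HasH10Gradient {d : ℕ} (P : Measure (Config d)) (f : Config d → ℝ)
    (G : Config d → Space d → Space d) : Prop where
  memLp : MemLp f 2 P
  measurable_grad : Measurable fun p : Config d × Space d => G p.1 p.2
  approx : ∃ φ : ℕ → Config d → ℝ,
    (∀ n, IsSmoothLocal (φ n) ∧ MemLp (φ n) 2 P ∧ energyOn P Set.univ (grad (φ n)) < ⊤) ∧
    Tendsto (fun n => eLpNorm (φ n - f) 2 P) atTop (𝓝 0) ∧
    Tendsto (fun n => energyOn P Set.univ fun μ x => grad (φ n) μ x - G μ x) atTop (𝓝 0)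

end PoissonConfig

/-
Resample the particles in the cube `Q` of edge length `l + 2k`: keep their number and redraw each
of them uniformly in `Q`. Let `μ` be a Poisson configuration and `ν` the resampled one, so that
`(μ, ν)` is exchangeable, and let `w = u - τ_h u`, an observable of the particles of `μ` in `Q`.
Given `ν`, the particles of `μ` in `Q` are uniform, and inside `Q` this law does not distinguish
the particles in `Q_l` from those in `Q_l + h`; hence `E[f(ν)² w(μ)] = 0`. Therefore
`E[f² w] = E[(f(μ)² - f(ν)²) w(μ)]`, and by Cauchy-Schwarz this is at most
`2 ‖w‖_∞ ‖f‖₂ E[(f(μ) - f(ν))²]^{1/2}`. The last factor is bounded by the Poincaré inequality in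
the cube, tensorized over the particles, and the case of a general `f = √g` follows by density.
-/

namespace PoissonConfig

open ProbabilityTheory

variable {d : ℕ}

section Tensorization

theorem enorm_sq_eq_ofReal (r : ℝ) : ‖r‖ₑ ^ 2 = ENNReal.ofReal (r ^ 2) := by
  rw [Real.enorm_eq_ofReal_abs, ← ENNReal.ofReal_pow (abs_nonneg r), sq_abs]

theorem enorm_sq_quadrilateral (a b c e : ℝ) :
    ‖a - b‖ₑ ^ 2 + ‖c - e‖ₑ ^ 2 ≤
      (‖a - e‖ₑ ^ 2 + ‖c - b‖ₑ ^ 2) + (‖a - c‖ₑ ^ 2 + ‖e - b‖ₑ ^ 2) := by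
  simp only [enorm_sq_eq_ofReal]
  repeat rw [← ENNReal.ofReal_add (by positivity) (by positivity)]
  exact ENNReal.ofReal_le_ofReal (by nlinarith [sq_nonneg (a + b - c - e)])

theorem lintegral_enorm_sub_comp_sq_le {Ω : Type*} [MeasurableSpace Ω] {m : Measure Ω}
    {A B : Ω → Ω} (hA : MeasurePreserving A m m) (hB : MeasurePreserving B m m)
    (hAA : Function.Involutive A) (hAB : Function.Commute A B) {φ : Ω → ℝ} (hφ : Measurable φ) :
    ∫⁻ z, ‖φ z - φ (A (B z))‖ₑ ^ 2 ∂m ≤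
      ∫⁻ z, ‖φ z - φ (A z)‖ₑ ^ 2 ∂m + ∫⁻ z, ‖φ z - φ (B z)‖ₑ ^ 2 ∂m := by
  have hmA := hA.measurable
  have hmB := hB.measurable
  have hdiag : ∫⁻ z, ‖φ (A z) - φ (B z)‖ₑ ^ 2 ∂m = ∫⁻ z, ‖φ z - φ (A (B z))‖ₑ ^ 2 ∂m := by
    rw [← hA.lintegral_comp (f := fun z => ‖φ z - φ (A (B z))‖ₑ ^ 2) (by fun_prop)]
    simp only [← hAB.eq _, hAA _]
  have hsideB : ∫⁻ z, ‖φ (A z) - φ (A (B z))‖ₑ ^ 2 ∂m = ∫⁻ z, ‖φ z - φ (B z)‖ₑ ^ 2 ∂m := by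
    rw [← hA.lintegral_comp (f := fun z => ‖φ z - φ (B z)‖ₑ ^ 2) (by fun_prop)]
    simp only [hAB.eq _]
  have hsideA : ∫⁻ z, ‖φ (B z) - φ (A (B z))‖ₑ ^ 2 ∂m = ∫⁻ z, ‖φ z - φ (A z)‖ₑ ^ 2 ∂m :=
    hB.lintegral_comp (f := fun z => ‖φ z - φ (A z)‖ₑ ^ 2) (by fun_prop)
  have hquad := lintegral_mono (μ := m) fun z =>
    enorm_sq_quadrilateral (φ z) (φ (A (B z))) (φ (A z)) (φ (B z))
  rw [lintegral_add_left (by fun_prop), lintegral_add_left (by fun_prop),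
    lintegral_add_left (by fun_prop), lintegral_add_left (by fun_prop), hdiag, hsideB, hsideA,
    ← two_mul, ← two_mul, ← two_mul, ← mul_add] at hquad
  rw [add_comm]
  exact (ENNReal.mul_le_mul_iff_right two_ne_zero ENNReal.ofNat_ne_top).1 hquad

variable {ι X : Type*} [DecidableEq ι]

/-- The exchange of the two points of the pair `z i`, for every `i ∈ S`. -/
def exchange (S : Finset ι) (z : ι → X × X) : ι → X × X :=
  fun i => if i ∈ S then (z i).swap else z i

theorem exchange_involutive (S : Finset ι) :
    Function.Involutive (exchange S : (ι → X × X) → ι → X × X) := fun z => by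
  ext1 i; by_cases h : i ∈ S <;> simp [exchange, h]

theorem exchange_commute (S T : Finset ι) :
    Function.Commute (exchange S : (ι → X × X) → ι → X × X) (exchange T) := fun z => by
  ext1 i; by_cases hS : i ∈ S <;> by_cases hT : i ∈ T <;> simp [exchange, hS, hT]

theorem exchange_insert {S : Finset ι} {i : ι} (hi : i ∉ S) (z : ι → X × X) :
    exchange (insert i S) z = exchange {i} (exchange S z) := by
  ext1 j
  by_cases hj : j = i
  · subst hj; simp [exchange, hi]
  · by_cases hS : j ∈ S <;> simp [exchange, hj, hS]

variable [Fintype ι] [MeasurableSpace X] {π : ι → Measure (X × X)} [∀ i, SigmaFinite (π i)]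

theorem measurePreserving_exchange (hπ : ∀ i, MeasurePreserving Prod.swap (π i) (π i))
    (S : Finset ι) : MeasurePreserving (exchange S) (Measure.pi π) (Measure.pi π) := by
  refine measurePreserving_pi π π (f := fun i q => if i ∈ S then q.swap else q) fun i => ?_
  by_cases h : i ∈ S
  · simpa only [h, if_true] using hπ i
  · simp only [h, if_false]
    exact MeasurePreserving.id _

theorem lintegral_enorm_sub_exchange_sq_le (hπ : ∀ i, MeasurePreserving Prod.swap (π i) (π i))
    {φ : (ι → X × X) → ℝ} (hφ : Measurable φ) (S : Finset ι) :
    ∫⁻ z, ‖φ z - φ (exchange S z)‖ₑ ^ 2 ∂Measure.pi π ≤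
      ∑ i ∈ S, ∫⁻ z, ‖φ z - φ (exchange {i} z)‖ₑ ^ 2 ∂Measure.pi π := by
  induction S using Finset.induction_on with
  | empty =>
    have hempty : ∀ z : ι → X × X, exchange ∅ z = z := fun z => by ext1 i; simp [exchange]
    simp [hempty]
  | insert i S hi ih =>
    rw [Finset.sum_insert hi]
    simp only [exchange_insert hi]
    refine (lintegral_enorm_sub_comp_sq_le (measurePreserving_exchange hπ _)
      (measurePreserving_exchange hπ _) (exchange_involutive _) (exchange_commute _ _) hφ).trans ?_
    gcongr

/-- The Efron–Stein inequality for a product of swap-invariant couplings: a Poincaré inequality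
in each coordinate gives one for the product, with the same constant. -/
theorem lintegral_enorm_sub_sq_pi_le (hπ : ∀ i, MeasurePreserving Prod.swap (π i) (π i))
    {ψ : (ι → X) → ℝ} (hψ : Measurable ψ) {e : ι → (ι → X) → ℝ≥0∞} (he : ∀ i, Measurable (e i))
    (h : ∀ i x, ∫⁻ q, ‖ψ (Function.update x i q.1) - ψ (Function.update x i q.2)‖ₑ ^ 2 ∂π i ≤
      ∫⁻ q, e i (Function.update x i q.1) ∂π i) :
    ∫⁻ z, ‖ψ (Prod.fst ∘ z) - ψ (Prod.snd ∘ z)‖ₑ ^ 2 ∂Measure.pi π ≤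
      ∫⁻ z, ∑ i, e i (Prod.fst ∘ z) ∂Measure.pi π := by
  have hfst : Measurable fun z : ι → X × X => Prod.fst ∘ z :=
    measurable_pi_lambda _ fun i => measurable_fst.comp (measurable_pi_apply i)
  have hφ : Measurable fun z : ι → X × X => ψ (Prod.fst ∘ z) := hψ.comp hfst
  have hall : ∀ z : ι → X × X, Prod.snd ∘ z = Prod.fst ∘ exchange Finset.univ z := fun z => by
    ext1 i; simp [exchange]
  simp only [hall]
  rw [lintegral_finsetSum Finset.univ (f := fun i (z : ι → X × X) => e i (Prod.fst ∘ z))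
    fun i _ => (he i).comp hfst]
  refine (lintegral_enorm_sub_exchange_sq_le hπ hφ _).trans (Finset.sum_le_sum fun i _ => ?_)
  have hex := (measurePreserving_exchange hπ {i}).measurable
  refine lintegral_le_of_lmarginal_le {i} (by fun_prop) ((he i).comp hfst) fun z => ?_
  have hupd : ∀ q : X × X, Prod.fst ∘ Function.update z i q =
      Function.update (Prod.fst ∘ z) i q.1 := fun q => Function.comp_update _ _ _ _
  have hexch : ∀ q : X × X, Prod.fst ∘ exchange {i} (Function.update z i q) =
      Function.update (Prod.fst ∘ z) i q.2 := fun q => by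
    ext1 j
    by_cases hj : j = i
    · subst hj; simp [exchange]
    · simp [exchange, hj]
  simpa only [lmarginal_singleton, hupd, hexch] using h i (Prod.fst ∘ z)

end Tensorization

section Poincare

theorem lintegral_sq_le {α : Type*} [MeasurableSpace α] (μ : Measure α) {f : α → ℝ≥0∞}
    (hf : AEMeasurable f μ) : (∫⁻ x, f x ∂μ) ^ 2 ≤ μ Set.univ * ∫⁻ x, f x ^ 2 ∂μ := by
  have h := ENNReal.lintegral_mul_le_Lp_mul_Lq μ Real.HolderConjugate.two_two
    (aemeasurable_const (b := (1 : ℝ≥0∞))) hf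
  simp only [Pi.mul_apply, one_mul, ENNReal.one_rpow, lintegral_one] at h
  rw [← ENNReal.mul_rpow_of_nonneg _ _ (by norm_num)] at h
  calc (∫⁻ x, f x ∂μ) ^ 2
      ≤ ((μ Set.univ * ∫⁻ x, f x ^ (2 : ℝ) ∂μ) ^ (1 / (2 : ℝ))) ^ 2 := by gcongr
    _ = μ Set.univ * ∫⁻ x, f x ^ 2 ∂μ := by
      rw [← ENNReal.rpow_natCast, ← ENNReal.rpow_mul]
      norm_num

theorem enorm_sub_sq_le_lintegral_deriv {a b s t : ℝ} (hs : s ∈ Set.Icc a b)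
    (ht : t ∈ Set.Icc a b) {f : ℝ → ℝ} (hf : ContDiff ℝ 1 f) :
    ‖f s - f t‖ₑ ^ 2 ≤ ENNReal.ofReal (b - a) * ∫⁻ r in Set.Icc a b, ‖deriv f r‖ₑ ^ 2 := by
  have hc : Continuous (deriv f) := hf.continuous_deriv le_rfl
  have hftc : f s - f t = ∫ r in t..s, deriv f r :=
    (intervalIntegral.integral_deriv_eq_sub
      (fun r _ => (hf.differentiable one_ne_zero).differentiableAt)
      (hc.intervalIntegrable _ _)).symm
  have hle : ‖f s - f t‖ₑ ≤ ∫⁻ r in Set.Icc a b, ‖deriv f r‖ₑ := by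
    rw [hftc, ← ofReal_norm, intervalIntegral.norm_intervalIntegral_eq, ofReal_norm]
    refine (enorm_integral_le_lintegral_enorm _).trans (lintegral_mono_set ?_)
    exact Set.uIoc_subset_uIcc.trans (Set.uIcc_subset_Icc ht hs)
  have hcs := lintegral_sq_le (volume.restrict (Set.Icc a b)) hc.measurable.enorm.aemeasurable
  rw [Measure.restrict_apply_univ, Real.volume_Icc] at hcs
  exact (by gcongr : _ ≤ (∫⁻ r in Set.Icc a b, ‖deriv f r‖ₑ) ^ 2).trans hcs

theorem poincare_Icc (a b : ℝ) {f : ℝ → ℝ} (hf : ContDiff ℝ 1 f) :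
    ∫⁻ p, ‖f p.1 - f p.2‖ₑ ^ 2
        ∂((volume.restrict (Set.Icc a b)).prod (volume.restrict (Set.Icc a b))) ≤
      ENNReal.ofReal (b - a) ^ 2 * ∫⁻ p, ‖deriv f p.1‖ₑ ^ 2
        ∂((volume.restrict (Set.Icc a b)).prod (volume.restrict (Set.Icc a b))) := by
  have hI : ∀ᵐ s ∂(volume.restrict (Set.Icc a b)), s ∈ Set.Icc a b :=
    ae_restrict_mem measurableSet_Icc
  have : Continuous (deriv f) := hf.continuous_deriv le_rfl
  have : Continuous f := hf.continuous
  rw [lintegral_prod _ (by fun_prop), lintegral_prod _ (by fun_prop)]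
  calc _ ≤ ∫⁻ _ in Set.Icc a b, ∫⁻ _ in Set.Icc a b,
          ENNReal.ofReal (b - a) * ∫⁻ r in Set.Icc a b, ‖deriv f r‖ₑ ^ 2 := by
        refine lintegral_mono_ae (hI.mono fun s hs => lintegral_mono_ae (hI.mono fun t ht => ?_))
        exact enorm_sub_sq_le_lintegral_deriv hs ht hf
    _ = _ := by
      simp only [lintegral_const, Measure.restrict_apply_univ, Real.volume_Icc]
      rw [lintegral_mul_const' _ _ ENNReal.ofReal_ne_top]
      ring

theorem gradient_apply {f : Space d → ℝ} {x : Space d} (hf : DifferentiableAt ℝ f x) (j : Fin d) :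
    gradient f x j = lineDeriv ℝ f x (EuclideanSpace.single j 1) := by
  rw [hf.lineDeriv_eq_fderiv, ← inner_gradient_left,
    EuclideanSpace.inner_single_right]
  simp

theorem enorm_sq_eq_sum (v : Space d) : ‖v‖ₑ ^ 2 = ∑ j, ‖v j‖ₑ ^ 2 := by
  simp only [← ofReal_norm, ← ENNReal.ofReal_pow (norm_nonneg _)]
  rw [EuclideanSpace.real_norm_sq_eq, ENNReal.ofReal_sum_of_nonneg fun _ _ => sq_nonneg _]
  simp only [Real.norm_eq_abs, sq_abs]

theorem deriv_comp_toLp_update {f : Space d → ℝ} (hf : Differentiable ℝ f) (x : Fin d → ℝ)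
    (j : Fin d) (t : ℝ) :
    deriv (fun s => f (WithLp.toLp 2 (Function.update x j s))) t =
      gradient f (WithLp.toLp 2 (Function.update x j t)) j := by
  have hline : (fun s => f (WithLp.toLp 2 (Function.update x j s))) = fun s =>
      f (WithLp.toLp 2 (Function.update x j t) + (s - t) • EuclideanSpace.single j (1 : ℝ)) := by
    funext s
    congr 1
    ext k
    by_cases hk : k = j
    · subst hk; simp
    · simp [hk]
  rw [hline, deriv_comp_sub_const (f := fun r => f (WithLp.toLp 2 (Function.update x j t) +
    r • EuclideanSpace.single j (1 : ℝ))), sub_self, gradient_apply (hf _)]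
  simp [lineDeriv]

theorem cube_eq_preimage (d : ℕ) (l : ℝ) :
    cube d l = WithLp.ofLp ⁻¹' Set.univ.pi fun _ : Fin d => Set.Icc (-(l / 2)) (l / 2) := by
  ext x
  simp only [cube, Set.mem_ofPred_eq, Set.mem_preimage, Set.mem_pi, Set.mem_univ, true_imp_iff]

theorem isCompact_cube (d : ℕ) (l : ℝ) : IsCompact (cube d l) := by
  rw [cube_eq_preimage]
  exact (EuclideanSpace.equiv (Fin d) ℝ).toHomeomorph.isCompact_preimage.2
    (isCompact_univ_pi fun _ => isCompact_Icc)

theorem measurableSet_cube (d : ℕ) (l : ℝ) : MeasurableSet (cube d l) :=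
  (isCompact_cube d l).measurableSet

theorem measurePreserving_toLp_cube (d : ℕ) (l : ℝ) :
    MeasurePreserving (WithLp.toLp 2)
      (Measure.pi fun _ : Fin d => volume.restrict (Set.Icc (-(l / 2)) (l / 2)))
      (volume.restrict (cube d l)) := by
  have h := (PiLp.volume_preserving_toLp (Fin d)).restrict_preimage (measurableSet_cube d l)
  have hpre : (WithLp.toLp 2 : (Fin d → ℝ) → Space d) ⁻¹' cube d l =
      Set.univ.pi fun _ => Set.Icc (-(l / 2)) (l / 2) := by
    rw [cube_eq_preimage]
    rfl
  rwa [hpre, volume_pi, Measure.restrict_pi_pi] at h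

theorem poincare_cube (l : ℝ) {f : Space d → ℝ} (hf : ContDiff ℝ 1 f) :
    ∫⁻ p, ‖f p.1 - f p.2‖ₑ ^ 2
        ∂((volume.restrict (cube d l)).prod (volume.restrict (cube d l))) ≤
      ENNReal.ofReal l ^ 2 * ∫⁻ p, ‖gradient f p.1‖ₑ ^ 2
        ∂((volume.restrict (cube d l)).prod (volume.restrict (cube d l))) := by
  set ν := volume.restrict (Set.Icc (-(l / 2)) (l / 2))
  have hto := measurePreserving_toLp_cube d l
  have hT := (hto.prod hto).comp
    (measurePreserving_arrowProdEquivProdArrow ℝ ℝ (Fin d) (fun _ => ν) fun _ => ν)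
  have hfm := hf.continuous
  have hgm : Measurable (gradient f) := ((InnerProductSpace.toDual ℝ (Space d)).symm.continuous.comp
    (hf.continuous_fderiv one_ne_zero)).measurable
  rw [← hT.lintegral_comp (by fun_prop), ← hT.lintegral_comp (by fun_prop),
    ← lintegral_const_mul' _ _ (by finiteness)]
  simp only [enorm_sq_eq_sum, Finset.mul_sum]
  refine lintegral_enorm_sub_sq_pi_le (π := fun _ : Fin d => ν.prod ν)
    (ψ := fun x => f (WithLp.toLp 2 x))
    (e := fun j x => ENNReal.ofReal l ^ 2 * ‖gradient f (WithLp.toLp 2 x) j‖ₑ ^ 2)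
    (fun _ => Measure.measurePreserving_swap) (by fun_prop) (fun j => by fun_prop) fun j x => ?_
  rw [lintegral_const_mul' _ _ (by finiteness)]
  have h := poincare_Icc (-(l / 2)) (l / 2)
    (f := fun s => f (WithLp.toLp 2 (Function.update x j s)))
    (hf.comp (PiLp.contDiff_toLp.comp (contDiff_update 1 x j)))
  simpa only [deriv_comp_toLp_update (hf.differentiable one_ne_zero), sub_neg_eq_add,
    add_halves] using h

end Poincare

section ResampleIn

open Classical in
/-- The retraction onto `V` that sends every point outside `V` to `p`. -/
noncomputable def collapse {X : Type*} (V : Set X) (p x : X) : X :=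
  if x ∈ V then x else p

theorem collapse_of_mem {X : Type*} {V : Set X} {x : X} (h : x ∈ V) (p : X) :
    collapse V p x = x :=
  if_pos h

theorem collapse_of_notMem {X : Type*} {V : Set X} {x : X} (h : x ∉ V) (p : X) :
    collapse V p x = p :=
  if_neg h

variable {X : Type*} [MeasurableSpace X]

/-- The coupling of `ν` with itself that keeps a point outside `Q` and redraws a point of `Q`
independently in `Q`, according to `ν`. It has the mass of `ν`, also when `ν Q = 0`: the second
summand then vanishes, although its coefficient is infinite. -/
noncomputable def resampleIn (ν : Measure X) (Q : Set X) : Measure (X × X) :=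
  (ν.restrict Qᶜ).map (fun x => (x, x)) + (ν Q)⁻¹ • (ν.restrict Q).prod (ν.restrict Q)

variable (ν : Measure X) {Q : Set X}

theorem measurePreserving_swap_resampleIn [SFinite ν] (Q : Set X) :
    MeasurePreserving Prod.swap (resampleIn ν Q) (resampleIn ν Q) := by
  refine ⟨measurable_swap, ?_⟩
  rw [resampleIn, Measure.map_add _ _ measurable_swap, Measure.map_smul, Measure.prod_swap,
    Measure.map_map measurable_swap (by fun_prop)]
  rfl

theorem fst_resampleIn [IsFiniteMeasure ν] (hQ : MeasurableSet Q) : (resampleIn ν Q).fst = ν := by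
  have hmass : (ν Q)⁻¹ • ν Q • ν.restrict Q = ν.restrict Q := by
    by_cases h : ν Q = 0
    · simp [Measure.restrict_eq_zero.2 h]
    · rw [smul_smul, ENNReal.inv_mul_cancel h (measure_ne_top ν Q), one_smul]
  rw [Measure.fst, resampleIn, Measure.map_add _ _ measurable_fst, Measure.map_smul,
    Measure.map_map measurable_fst (by fun_prop), Measure.map_fst_prod,
    Measure.restrict_apply_univ, hmass]
  exact (congrArg (· + _) Measure.map_id).trans (Measure.restrict_compl_add_restrict hQ)

instance [IsFiniteMeasure ν] (Q : Set X) : IsFiniteMeasure (resampleIn ν Q) := by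
  refine ⟨?_⟩
  rw [resampleIn, Measure.add_apply, Measure.smul_apply, ← Set.univ_prod_univ, Measure.prod_prod,
    Measure.restrict_apply_univ, smul_eq_mul, ← mul_assoc]
  exact ENNReal.add_lt_top.2 ⟨measure_lt_top _ _,
    ENNReal.mul_lt_top ((ENNReal.inv_mul_le_one _).trans_lt ENNReal.one_lt_top)
      (measure_lt_top ν Q)⟩

theorem resampleIn_map_eq [SFinite ν] (hQ : MeasurableSet Q) {T T' : X → X} (hT : Measurable T)
    (hT' : Measurable T') (hTT' : Set.EqOn T T' Qᶜ)
    (hmap : (ν.restrict Q).map T = (ν.restrict Q).map T') :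
    (resampleIn ν Q).map (Prod.map T id) = (resampleIn ν Q).map (Prod.map T' id) := by
  have hout : (ν.restrict Qᶜ).map (fun x => (T x, x)) = (ν.restrict Qᶜ).map fun x => (T' x, x) :=
    Measure.map_congr <| (ae_restrict_mem hQ.compl).mono fun x hx => by
      simp only [hTT' hx]
  have hin : ((ν.restrict Q).prod (ν.restrict Q)).map (Prod.map T id) =
      ((ν.restrict Q).prod (ν.restrict Q)).map (Prod.map T' id) := by
    rw [← Measure.map_prod_map _ _ hT measurable_id, ← Measure.map_prod_map _ _ hT' measurable_id,
      hmap]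
  rw [resampleIn, Measure.map_add _ _ (by fun_prop), Measure.map_add _ _ (by fun_prop),
    Measure.map_smul, Measure.map_smul, hin, Measure.map_map (by fun_prop) (by fun_prop),
    Measure.map_map (by fun_prop) (by fun_prop)]
  exact congrArg (· + _) hout

theorem poincare_resampleIn {l : ℝ} (ν : Measure (Space d))
    (hν : ν.restrict (cube d l) = volume.restrict (cube d l)) {f : Space d → ℝ}
    (hf : ContDiff ℝ 1 f) :
    ∫⁻ q, ‖f q.1 - f q.2‖ₑ ^ 2 ∂resampleIn ν (cube d l) ≤
      ENNReal.ofReal l ^ 2 *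
        ∫⁻ q, (cube d l).indicator (fun x => ‖gradient f x‖ₑ ^ 2) q.1 ∂resampleIn ν (cube d l) := by
  have hfc := hf.continuous
  have hdiag : ∫⁻ q, ‖f q.1 - f q.2‖ₑ ^ 2 ∂(ν.restrict (cube d l)ᶜ).map (fun x => (x, x)) = 0 := by
    rw [lintegral_map (by fun_prop) (by fun_prop)]
    simp
  have hmem : ∀ᵐ q ∂(volume.restrict (cube d l)).prod (volume.restrict (cube d l)),
      q.1 ∈ cube d l :=
    Measure.quasiMeasurePreserving_fst.ae (ae_restrict_mem (measurableSet_cube d l))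
  rw [resampleIn, lintegral_add_measure, lintegral_add_measure, hdiag, zero_add,
    lintegral_smul_measure, lintegral_smul_measure, hν, mul_add]
  refine le_add_left ?_
  rw [smul_eq_mul, smul_eq_mul, mul_left_comm]
  gcongr
  refine (poincare_cube l hf).trans_eq ?_
  congr 1
  exact lintegral_congr_ae (hmem.mono fun q hq =>
    (Set.indicator_of_mem hq fun x => ‖gradient f x‖ₑ ^ 2).symm)

theorem measurable_collapse {V : Set X} (hV : MeasurableSet V) (p : X) :
    Measurable (collapse V p) :=
  Measurable.ite hV measurable_id measurable_const

theorem map_restrict_collapse (μ : Measure X) {V : Set X} (hV : MeasurableSet V)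
    (hQ : MeasurableSet Q) (hVQ : V ⊆ Q) (p : X) :
    (μ.restrict Q).map (collapse V p) = μ.restrict V + μ (Q \ V) • Measure.dirac p := by
  have hin : (μ.restrict V).map (collapse V p) = μ.restrict V :=
    (Measure.map_congr <| (ae_restrict_mem hV).mono fun x hx => collapse_of_mem hx p).trans
      Measure.map_id
  have hout : (μ.restrict (Q \ V)).map (collapse V p) = μ (Q \ V) • Measure.dirac p := by
    rw [← Measure.restrict_apply_univ (μ := μ) (Q \ V), ← Measure.map_const]
    exact Measure.map_congr <| (ae_restrict_mem (hQ.diff hV)).mono fun x hx =>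
      collapse_of_notMem hx.2 p
  rw [← Set.union_sdiff_cancel hVQ, Measure.restrict_union Set.disjoint_sdiff_right (hQ.diff hV),
    Measure.map_add _ _ (measurable_collapse hV p), hin, hout, Set.union_sdiff_cancel hVQ]

theorem map_restrict_collapse_sub [AddGroup X] [MeasurableAdd X] (μ : Measure X)
    [μ.IsAddRightInvariant] {V : Set X} (hV : MeasurableSet V) (hQ : MeasurableSet Q)
    (hμV : μ V ≠ ⊤) (hVQ : V ⊆ Q) {h : X} (hhV : ∀ x, x - h ∈ V → x ∈ Q) (p : X) :
    (μ.restrict Q).map (fun x => collapse V p (x - h)) = (μ.restrict Q).map (collapse V p) := by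
  have hsub : MeasurePreserving (fun x => x - h) μ μ := measurePreserving_sub_right μ h
  have hadd : Measurable fun x => x + h := measurable_add_const h
  have hsubm : Measurable fun x => x - h := hsub.measurable
  have hQh : (fun x => x - h) ⁻¹' ((fun x => x + h) ⁻¹' Q) = Q := by ext; simp
  have hres := hsub.restrict_preimage (hadd hQ)
  have hμQ := hsub.measure_preimage (hadd hQ).nullMeasurableSet
  rw [hQh] at hres hμQ
  have hVQh : V ⊆ (fun x => x + h) ⁻¹' Q := fun x hx => hhV (x + h) (by simpa using hx)
  calc (μ.restrict Q).map (fun x => collapse V p (x - h))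
      = (μ.restrict ((fun x => x + h) ⁻¹' Q)).map (collapse V p) := by
        rw [← hres.map_eq, Measure.map_map (measurable_collapse hV p) hsubm]; rfl
    _ = (μ.restrict Q).map (collapse V p) := by
        rw [map_restrict_collapse μ hV (hadd hQ) hVQh, map_restrict_collapse μ hV hQ hVQ,
          measure_sdiff hVQh hV.nullMeasurableSet hμV, measure_sdiff hVQ hV.nullMeasurableSet hμV,
          hμQ]

end ResampleIn

section Observables

theorem sigmaAlg_mono {U V : Set (Space d)} (h : U ⊆ V) : sigmaAlg U ≤ sigmaAlg V :=
  iSup_mono fun _ => iSup_mono fun _ => iSup_le fun hU => le_iSup_of_le (hU.trans h) le_rfl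

theorem measurable_apply {U V : Set (Space d)} (hV : MeasurableSet V) (h : V ⊆ U) :
    Measurable[sigmaAlg U] fun μ : Config d => μ.1 V :=
  Measurable.mono (comap_measurable _)
    (le_iSup_of_le V (le_iSup_of_le hV (le_iSup_of_le h le_rfl))) le_rfl

theorem measurable_sigmaAlg_of_apply {α : Type*} {m : MeasurableSpace α} {U : Set (Space d)}
    {f : α → Config d} (h : ∀ V, MeasurableSet V → V ⊆ U → Measurable fun a => (f a).1 V) :
    Measurable[m, sigmaAlg U] f := by
  refine Measurable.of_comap_le ?_
  simp only [sigmaAlg, MeasurableSpace.comap_iSup, MeasurableSpace.comap_comp]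
  exact iSup_le fun V => iSup_le fun hV => iSup_le fun hU => (h V hV hU).comap_le

theorem measurable_of_sigmaAlg {β : Type*} [MeasurableSpace β] {U : Set (Space d)}
    {f : Config d → β} (h : Measurable[sigmaAlg U] f) : Measurable f :=
  h.mono (sigmaAlg_mono (Set.subset_univ U)) le_rfl

theorem eq_of_measurable_sigmaAlg {β : Type*} [MeasurableSpace β] [MeasurableSingletonClass β]
    {U : Set (Space d)} {f : Config d → β} (hf : Measurable[sigmaAlg U] f) {μ ν : Config d}
    (h : ∀ V, MeasurableSet V → V ⊆ U → μ.1 V = ν.1 V) : f μ = f ν := by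
  -- `f` factors through the family of the occupation numbers `μ V`, `V ⊆ U`, seen with the
  -- discrete `σ`-algebra.
  let r : Config d → Set (Space d) → ℝ≥0∞ := fun μ V => ⨆ (_ : MeasurableSet V ∧ V ⊆ U), μ.1 V
  have hr : r μ = r ν := funext fun V => iSup_congr fun hV => h V hV.1 hV.2
  have hle : sigmaAlg U ≤ MeasurableSpace.comap r ⊤ := by
    refine iSup_le fun V => iSup_le fun hV => iSup_le fun hU => ?_
    rintro _ ⟨s, -, rfl⟩
    refine ⟨{q | q V ∈ s}, trivial, ?_⟩
    ext μ
    simp [r, hV, hU]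
  obtain ⟨s, -, hs⟩ := hle _ (hf (measurableSet_singleton (f μ)))
  have hμ : μ ∈ r ⁻¹' s := by rw [hs]; rfl
  have hν : ν ∈ r ⁻¹' s := by rwa [Set.mem_preimage, ← hr]
  rw [hs] at hν
  exact hν.symm

theorem IsPointMeasure.restrict {μ : Measure (Space d)} (hμ : IsPointMeasure μ)
    {U : Set (Space d)} (hU : MeasurableSet U) : IsPointMeasure (μ.restrict U) := by
  obtain ⟨h1, ι, _, p, rfl⟩ := hμ
  refine ⟨inferInstance, {i | p i ∈ U}, inferInstance, fun i => p i, ?_⟩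
  have hin : ∀ i : {i | p i ∈ U}, (Measure.dirac (p i)).restrict U = Measure.dirac (p i) := by
    rintro ⟨i, hi⟩
    classical exact (restrict_dirac' hU).trans (if_pos hi)
  have hout : ∀ i : ({i | p i ∈ U}ᶜ : Set ι), (Measure.dirac (p i)).restrict U = 0 := by
    rintro ⟨i, hi⟩
    classical exact (restrict_dirac' hU).trans (if_neg hi)
  rw [← Measure.sum_add_sum_compl {i | p i ∈ U}, Measure.restrict_add, Measure.restrict_sum _ hU,
    Measure.restrict_sum _ hU]
  simp only [hin, hout, Measure.sum_zero, add_zero]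

/-- The configuration of the particles of `μ` in `U`. -/
noncomputable def restrictTo {U : Set (Space d)} (hU : MeasurableSet U) (μ : Config d) :
    Config d :=
  ⟨μ.1.restrict U, μ.2.restrict hU⟩

theorem restrictTo_apply {U V : Set (Space d)} (hU : MeasurableSet U) (h : V ⊆ U)
    (μ : Config d) : (restrictTo hU μ).1 V = μ.1 V :=
  Measure.restrict_eq_self _ h

theorem measurable_restrictTo {U : Set (Space d)} (hU : MeasurableSet U) :
    Measurable[sigmaAlg U, sigmaAlg Set.univ] (restrictTo hU) := by
  refine measurable_sigmaAlg_of_apply fun V hV _ => ?_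
  simp only [restrictTo, Measure.restrict_apply hV]
  exact measurable_apply (hV.inter hU) Set.inter_subset_right

end Observables

section FiniteConfigurations

theorem ofPoints_apply {N : ℕ} (x : Fin N → Space d) {V : Set (Space d)} (hV : MeasurableSet V) :
    (ofPoints x).1 V = ∑ i, V.indicator 1 (x i) := by
  simp [ofPoints, Measure.dirac_apply' _ hV]

theorem measurable_ofPoints {N : ℕ} :
    Measurable (ofPoints : (Fin N → Space d) → Config d) := by
  refine measurable_sigmaAlg_of_apply fun V hV _ => ?_
  simp only [ofPoints_apply _ hV]
  exact Finset.measurable_sum _ fun i _ =>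
    (measurable_one.indicator hV).comp (measurable_pi_apply i)

theorem exists_eq_ofPoints (μ : Config d) (hμ : IsFiniteMeasure μ.1) :
    ∃ (N : ℕ) (x : Fin N → Space d), μ = ofPoints x := by
  obtain ⟨-, ι, _, p, hp⟩ := μ.2
  have hι : Finite ι := by
    by_contra h
    rw [not_finite_iff_infinite] at h
    have hmass := measure_ne_top μ.1 Set.univ
    rw [hp, Measure.sum_apply _ MeasurableSet.univ] at hmass
    simp at hmass
  have := Fintype.ofFinite ι
  let e := Fintype.equivFin ι
  refine ⟨_, fun j => p (e.symm j), Subtype.ext ?_⟩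
  exact (hp.trans (Measure.sum_fintype _)).trans (e.symm.sum_comp fun i => Measure.dirac (p i)).symm

theorem translate_apply (h : Space d) (μ : Config d) {V : Set (Space d)} (hV : MeasurableSet V) :
    (translate h μ).1 V = μ.1 ((fun x => x + h) ⁻¹' V) := by
  simp [translate, Measure.map_apply (measurable_add_const h) hV]

theorem measurable_translate (h : Space d) : Measurable (translate h : Config d → Config d) := by
  refine measurable_sigmaAlg_of_apply fun V hV _ => ?_
  simp only [translate_apply h _ hV]
  exact measurable_apply (measurable_add_const h hV) (Set.subset_univ _)

theorem translate_ofPoints {N : ℕ} (h : Space d) (x : Fin N → Space d) :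
    translate h (ofPoints x) = ofPoints fun i => x i + h := by
  refine Subtype.ext (Measure.ext fun V hV => ?_)
  rw [translate_apply h _ hV, ofPoints_apply _ hV, ofPoints_apply _ (measurable_add_const h hV)]
  rfl

theorem translate_zero (μ : Config d) : translate 0 μ = μ :=
  Subtype.ext (by simp [translate])

theorem move_apply (μ : Config d) (x y : Space d) {B : Set (Space d)} (hB : MeasurableSet B) :
    (move μ x y).1 B = μ.1 (B ∩ {x}ᶜ) + (μ.1 (B ∩ {x}) - 1) * B.indicator 1 x +
      B.indicator 1 y := by
  have h : (move μ x y).1 B = (μ.1.restrict {x}ᶜ B + (μ.1 {x} - 1) * Measure.dirac x B) +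
      Measure.dirac y B := rfl
  rw [h, Measure.restrict_apply hB, Measure.dirac_apply' _ hB, Measure.dirac_apply' _ hB]
  congr 2
  by_cases hx : x ∈ B
  · rw [Set.inter_eq_right.2 (Set.singleton_subset_iff.2 hx)]
  · simp [hx]

theorem erase_add_dirac (ν : Measure (Space d)) (x : Space d) :
    (ν + Measure.dirac x).restrict {x}ᶜ + ((ν + Measure.dirac x) {x} - 1) • Measure.dirac x =
      ν := by
  classical
  have h : (Measure.dirac x).restrict {x}ᶜ = 0 := by
    rw [restrict_dirac' (measurableSet_singleton x).compl, if_neg (by simp)]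
  rw [Measure.restrict_add, h, add_zero, Measure.add_apply,
    Measure.dirac_apply_of_mem (Set.mem_singleton x),
    ENNReal.add_sub_cancel_right ENNReal.one_ne_top, ← Measure.restrict_singleton,
    Measure.restrict_compl_add_restrict (measurableSet_singleton x)]

theorem move_ofPoints {N : ℕ} (x : Fin N → Space d) (i : Fin N) (y : Space d) :
    move (ofPoints x) (x i) y = ofPoints (Function.update x i y) := by
  have hsplit : ∀ z : Fin N → Space d, (ofPoints z).1 =
      ∑ j ∈ Finset.univ.erase i, Measure.dirac (z j) + Measure.dirac (z i) :=
    fun z => (Finset.sum_erase_add _ _ (Finset.mem_univ i)).symm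
  have hrest : ∑ j ∈ Finset.univ.erase i, Measure.dirac (Function.update x i y j) =
      ∑ j ∈ Finset.univ.erase i, Measure.dirac (x j) :=
    Finset.sum_congr rfl fun j hj => by rw [Function.update_of_ne (Finset.ne_of_mem_erase hj)]
  refine Subtype.ext ?_
  rw [hsplit (Function.update x i y), hrest, Function.update_self]
  simp only [move, hsplit x, erase_add_dirac]

end FiniteConfigurations

section Gradient

theorem isSFiniteKernel_of_isFiniteMeasure {α β : Type*} [MeasurableSpace α] [MeasurableSpace β]
    (κ : Kernel α β) (hκ : ∀ a, IsFiniteMeasure (κ a)) :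
    IsSFiniteKernel κ := by
  classical
  let n : α → ℕ := fun a => ⌊(κ a Set.univ).toNNReal⌋₊
  have hn : Measurable n :=
    Nat.measurable_floor.comp (κ.measurable_coe MeasurableSet.univ).ennreal_toNNReal
  have hlevel (k : ℕ) : MeasurableSet (n ⁻¹' {k}) := hn (measurableSet_singleton k)
  refine ⟨fun k => .piecewise (hlevel k) κ 0, fun k => ⟨k + 1, by finiteness, fun a => ?_⟩, ?_⟩
  · rw [Kernel.piecewise_apply]
    split_ifs with h
    · rw [← ENNReal.coe_toNNReal (measure_ne_top (κ a) Set.univ)]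
      obtain rfl : n a = k := h
      exact_mod_cast (Nat.lt_floor_add_one (κ a Set.univ).toNNReal).le
    · simp
  · ext a s hs
    rw [Kernel.sum_apply' _ _ hs, tsum_eq_single (n a)]
    · rw [Kernel.piecewise_apply, if_pos (show a ∈ n ⁻¹' {n a} from rfl)]
    · intro k hk
      rw [Kernel.piecewise_apply, if_neg (show a ∉ n ⁻¹' {k} from Ne.symm hk)]
      rfl

/-- The kernel `μ ↦ μ`, which integrates a field over the particles of a configuration. -/
noncomputable def particleKernel (d : ℕ) : Kernel (Config d) (Space d) :=
  ⟨fun μ => μ.1, Measure.measurable_of_measurable_coe _ fun _ hV =>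
    measurable_apply hV (Set.subset_univ _)⟩

instance : IsSFiniteKernel (particleKernel d) := by
  let B : ℕ → Set (Space d) := disjointed fun n => Metric.closedBall 0 n
  have hB : ∀ n, MeasurableSet (B n) :=
    MeasurableSet.disjointed fun n => Metric.isClosed_closedBall.measurableSet
  have hκ : particleKernel d = .sum fun n => (particleKernel d).restrict (hB n) := by
    ext1 μ
    simp only [Kernel.sum_apply, Kernel.restrict_apply]
    rw [← Measure.restrict_iUnion (disjoint_disjointed _) hB, iUnion_disjointed,
      Metric.iUnion_closedBall_nat, Measure.restrict_univ]
  have hsfinite n : IsSFiniteKernel ((particleKernel d).restrict (hB n)) := by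
    refine isSFiniteKernel_of_isFiniteMeasure _ fun μ => ⟨?_⟩
    have : IsLocallyFiniteMeasure (particleKernel d μ) := μ.2.1
    rw [Kernel.restrict_apply, Measure.restrict_apply_univ]
    exact (Metric.isBounded_closedBall.subset (disjointed_subset _ n)).measure_lt_top
  rw [hκ]
  infer_instance

theorem measurable_move :
    Measurable fun q : Config d × Space d × Space d => move q.1 q.2.1 q.2.2 := by
  refine measurable_sigmaAlg_of_apply fun B hB _ => ?_
  simp only [move_apply _ _ _ hB]
  have hcount {t : Set ((Config d × Space d × Space d) × Space d)} (ht : MeasurableSet t) :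
      Measurable fun q : Config d × Space d × Space d => q.1.1 (Prod.mk q ⁻¹' t) :=
    Kernel.measurable_kernel_prodMk_left
      (κ := (particleKernel d).comap Prod.fst measurable_fst) ht
  have hdiag : MeasurableSet {q : (Config d × Space d × Space d) × Space d | q.2 = q.1.2.1} :=
    measurableSet_eq_fun (by fun_prop) (by fun_prop)
  have hBq : MeasurableSet {q : (Config d × Space d × Space d) × Space d | q.2 ∈ B} :=
    measurable_snd hB
  have hind : Measurable (B.indicator (1 : Space d → ℝ≥0∞)) := measurable_one.indicator hB
  exact ((hcount (hBq.inter hdiag.compl)).add (((hcount (hBq.inter hdiag)).sub_const 1).mul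
    (hind.comp (by fun_prop)))).add (hind.comp (by fun_prop))

theorem exists_move_eq {V : Set (Space d)} (hV : IsCompact V) {f : Config d → ℝ}
    (hf : Measurable[sigmaAlg V] f) (μ : Config d) (x : Space d) :
    ∃ (N : ℕ) (p : Fin N → Space d),
      ∀ y, f (move μ x y) = f (ofPoints (Fin.cons y p : Fin (N + 1) → Space d)) := by
  let ν : Config d := ⟨_, μ.2.erase x⟩
  have hνV : IsFiniteMeasure (restrictTo hV.measurableSet ν).1 := by
    have := ν.2.1
    exact ⟨by simpa [restrictTo] using hV.measure_lt_top⟩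
  obtain ⟨N, p, hp⟩ := exists_eq_ofPoints _ hνV
  refine ⟨N, p, fun y => eq_of_measurable_sigmaAlg hf fun B hB hBV => ?_⟩
  have hmove : (move μ x y).1 B = ν.1 B + Measure.dirac y B := rfl
  rw [hmove, ← restrictTo_apply hV.measurableSet hBV, hp, ofPoints_apply _ hB, ofPoints_apply _ hB,
    Fin.sum_univ_succ, Measure.dirac_apply' _ hB, add_comm]
  simp only [Fin.cons_zero, Fin.cons_succ]

variable {f : Config d → ℝ}

theorem IsSmoothLocal.differentiableAt_move (hf : IsSmoothLocal f) (μ : Config d) (x y : Space d) :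
    DifferentiableAt ℝ (fun y => f (move μ x y)) y := by
  obtain ⟨V, hV, hfV⟩ := hf.local_meas
  obtain ⟨N, p, hp⟩ := exists_move_eq hV hfV μ x
  simp_rw [hp]
  refine ((hf.smooth (N + 1)).differentiable (by simp) (Fin.cons y p)).comp y
    (f := fun y => (Fin.cons y p : Fin (N + 1) → Space d)) ?_
  rw [differentiableAt_pi]
  refine Fin.cases ?_ fun i => ?_
  · simp only [Fin.cons_zero]; fun_prop
  · simp only [Fin.cons_succ]; fun_prop

theorem IsSmoothLocal.grad_eq (hf : IsSmoothLocal f) (μ : Config d) (x : Space d) :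
    grad f μ x = gradient (fun y => f (move μ x y)) x :=
  PiLp.ext fun j => (gradient_apply (hf.differentiableAt_move μ x x) j).symm

theorem IsSmoothLocal.measurable (hf : IsSmoothLocal f) : Measurable f :=
  let ⟨_, _, hfV⟩ := hf.local_meas
  measurable_of_sigmaAlg hfV

theorem IsSmoothLocal.measurable_grad (hf : IsSmoothLocal f) :
    Measurable fun p : Config d × Space d => grad f p.1 p.2 := by
  refine (PiLp.continuous_toLp 2 _).measurable.comp (measurable_pi_lambda _ fun k => ?_)
  let e : Space d := EuclideanSpace.single k 1
  have hmove (t : ℝ) :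
      Measurable fun p : Config d × Space d => f (move p.1 p.2 (p.2 + t • e)) :=
    hf.measurable.comp (measurable_move.comp
      (f := fun p : Config d × Space d => (p.1, p.2, p.2 + t • e)) (by fun_prop))
  refine measurable_of_tendsto_metrizable (f := fun (n : ℕ) (p : Config d × Space d) =>
    ((n : ℝ) + 1) * (f (move p.1 p.2 (p.2 + ((n : ℝ) + 1)⁻¹ • e)) -
      f (move p.1 p.2 (p.2 + (0 : ℝ) • e))))
    (fun n => ((hmove _).sub (hmove 0)).const_mul _) (tendsto_pi_nhds.2 fun p => ?_)
  have hdiff : DifferentiableAt ℝ (fun t : ℝ => f (move p.1 p.2 (p.2 + t • e))) 0 :=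
    (hf.differentiableAt_move p.1 p.2 (p.2 + (0 : ℝ) • e)).comp (0 : ℝ)
      (f := fun t : ℝ => p.2 + t • e) (by fun_prop)
  have hn : Tendsto (fun n : ℕ => ((n : ℝ) + 1)⁻¹) atTop (𝓝[≠] 0) := by
    refine tendsto_nhdsWithin_iff.2 ⟨?_, Eventually.of_forall fun n => ?_⟩
    · simpa only [one_div] using tendsto_one_div_add_atTop_nhds_zero_nat (𝕜 := ℝ)
    · exact inv_ne_zero (by positivity)
  refine (hdiff.hasDerivAt.tendsto_slope.comp hn).congr fun n => ?_
  simp [slope_def_field, div_eq_inv_mul]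

theorem IsSmoothLocal.grad_ofPoints_update (hf : IsSmoothLocal f) {N : ℕ} (x : Fin N → Space d)
    (i : Fin N) (y : Space d) :
    grad f (ofPoints (Function.update x i y)) y =
      gradient (fun z => f (ofPoints (Function.update x i z))) y := by
  have h (z : Space d) : move (ofPoints (Function.update x i y)) y z =
      ofPoints (Function.update x i z) := by
    have := move_ofPoints (Function.update x i y) i z
    rwa [Function.update_self, Function.update_idem] at this
  simp_rw [hf.grad_eq, h]

theorem grad_restrictTo {U : Set (Space d)} (hU : MeasurableSet U) (hf : Measurable[sigmaAlg U] f)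
    (μ : Config d) (x : Space d) : grad f (restrictTo hU μ) x = grad f μ x := by
  have h (y : Space d) : f (move (restrictTo hU μ) x y) = f (move μ x y) := by
    refine eq_of_measurable_sigmaAlg hf fun B hB hBU => ?_
    rw [move_apply _ _ _ hB, move_apply _ _ _ hB,
      restrictTo_apply hU (Set.inter_subset_left.trans hBU),
      restrictTo_apply hU (Set.inter_subset_left.trans hBU)]
  simp only [grad, h]

/-- The energy `∫_Q |∇f(μ, x)|² dμ(x)` carried by the particles of `μ` in `Q`. -/
noncomputable def gradEnergy (Q : Set (Space d)) (f : Config d → ℝ) (μ : Config d) : ℝ≥0∞ :=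
  ∫⁻ x in Q, ‖grad f μ x‖ₑ ^ 2 ∂μ.1

theorem gradEnergy_restrictTo {Q U : Set (Space d)} (hQ : MeasurableSet Q) (hU : MeasurableSet U)
    (hQU : Q ⊆ U) (hf : Measurable[sigmaAlg U] f) (μ : Config d) :
    gradEnergy Q f (restrictTo hU μ) = gradEnergy Q f μ := by
  simp only [gradEnergy, grad_restrictTo hU hf]
  simp only [restrictTo, Measure.restrict_restrict hQ, Set.inter_eq_left.2 hQU]

theorem IsSmoothLocal.measurable_gradEnergy (hf : IsSmoothLocal f) {Q U : Set (Space d)}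
    (hQ : MeasurableSet Q) (hU : MeasurableSet U) (hQU : Q ⊆ U) (hfU : Measurable[sigmaAlg U] f) :
    Measurable[sigmaAlg U] (gradEnergy Q f) := by
  have h : Measurable (gradEnergy Q f) :=
    (hf.measurable_grad.enorm.pow_const 2).lintegral_kernel_prod_right'
      (κ := (particleKernel d).restrict hQ)
  rw [← funext (gradEnergy_restrictTo hQ hU hQU hfU)]
  exact h.comp (measurable_restrictTo hU)

theorem IsSmoothLocal.gradEnergy_ofPoints (hf : IsSmoothLocal f) {Q : Set (Space d)}
    (hQ : MeasurableSet Q) {N : ℕ} (x : Fin N → Space d) :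
    gradEnergy Q f (ofPoints x) =
      ∑ i, Q.indicator (fun y => ‖grad f (ofPoints x) y‖ₑ ^ 2) (x i) := by
  have hm : Measurable fun y => ‖grad f (ofPoints x) y‖ₑ ^ 2 :=
    (hf.measurable_grad.comp measurable_prodMk_left).enorm.pow_const 2
  have hpoints : (ofPoints x).1 = ∑ i, Measure.dirac (x i) := rfl
  rw [gradEnergy, ← lintegral_indicator hQ, hpoints, lintegral_finsetSum_measure]
  exact Finset.sum_congr rfl fun i _ => lintegral_dirac' _ (hm.indicator hQ)

end Gradient

section PoissonCoupling

theorem identDistrib_of_lintegral_eq {α β γ : Type*} [MeasurableSpace α] [MeasurableSpace β]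
    [MeasurableSpace γ] {μ : Measure α} {ν : Measure β} {f : α → γ} {g : β → γ} (hf : Measurable f)
    (hg : Measurable g)
    (h : ∀ F : γ → ℝ≥0∞, Measurable F → ∫⁻ a, F (f a) ∂μ = ∫⁻ b, F (g b) ∂ν) :
    IdentDistrib f g μ ν :=
  ⟨hf.aemeasurable, hg.aemeasurable, Measure.ext_of_lintegral _ fun F hF => by
    rw [lintegral_map hF hf, lintegral_map hF hg, h F hF]⟩

/-- The density `e^{-ρ|U|} ρ^N / N!`, with respect to Lebesgue measure on `U^N`, of `N` labelled
particles of the Poisson process in `U`. -/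
noncomputable def poissonWeight (ρ : ℝ) (U : Set (Space d)) (N : ℕ) : ℝ≥0∞ :=
  ENNReal.ofReal (Real.exp (-(ρ * (volume U).toReal)) * ρ ^ N / N.factorial)

/-- The joint law of the particles in `U` of a Poisson process and of the configuration obtained
by resampling, independently, the positions of those that lie in `Q`. -/
noncomputable def resampleConfig (ρ : ℝ) (Q U : Set (Space d)) :
    Measure (Config d × Config d) :=
  Measure.sum fun N => poissonWeight ρ U N •
    (Measure.pi fun _ : Fin N => resampleIn (volume.restrict U) Q).map
      fun z => (ofPoints (Prod.fst ∘ z), ofPoints (Prod.snd ∘ z))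

theorem IsPoisson.isProbabilityMeasure {ρ : ℝ} {P : Measure (Config d)} (hP : IsPoisson ρ P) :
    IsProbabilityMeasure P := by
  have h := hP ∅ MeasurableSet.empty Bornology.isBounded_empty 1 measurable_const
  rw [tsum_eq_single 0 fun N hN => by
    have : Nonempty (Fin N) := Fin.pos_iff_nonempty.1 (Nat.pos_of_ne_zero hN)
    simp] at h
  exact ⟨by simpa [volume_pi, Measure.pi_pi] using h⟩

theorem measurable_ofPoints_pair {N : ℕ} : Measurable fun z : Fin N → Space d × Space d =>
    ((ofPoints (Prod.fst ∘ z), ofPoints (Prod.snd ∘ z)) : Config d × Config d) :=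
  (measurable_ofPoints.comp (measurable_pi_lambda _ fun i =>
    measurable_fst.comp (measurable_pi_apply i))).prodMk
  (measurable_ofPoints.comp (measurable_pi_lambda _ fun i =>
    measurable_snd.comp (measurable_pi_apply i)))

theorem lintegral_resampleConfig (ρ : ℝ) (Q U : Set (Space d)) {F : Config d × Config d → ℝ≥0∞}
    (hF : Measurable F) :
    ∫⁻ q, F q ∂resampleConfig ρ Q U = ∑' N, poissonWeight ρ U N *
      ∫⁻ z, F (ofPoints (Prod.fst ∘ z), ofPoints (Prod.snd ∘ z))
        ∂(Measure.pi fun _ : Fin N => resampleIn (volume.restrict U) Q) := by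
  simp only [resampleConfig, lintegral_sum_measure, lintegral_smul_measure,
    lintegral_map hF measurable_ofPoints_pair, smul_eq_mul]

variable {ρ : ℝ} {Q U : Set (Space d)} [IsFiniteMeasure (volume.restrict U)]

theorem map_fst_comp_pi_resampleIn (hQ : MeasurableSet Q) (N : ℕ) :
    (Measure.pi fun _ : Fin N => resampleIn (volume.restrict U) Q).map (Prod.fst ∘ ·) =
      volume.restrict (Set.univ.pi fun _ => U) := by
  have hfst := fst_resampleIn (volume.restrict U) hQ
  have (_ : Fin N) : SigmaFinite ((resampleIn (volume.restrict U) Q).map Prod.fst) := by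
    rw [← Measure.fst, hfst]; infer_instance
  exact (Measure.pi_map_pi fun _ => measurable_fst.aemeasurable).trans
    (by rw [volume_pi, Measure.restrict_pi_pi, ← Measure.fst, hfst])

theorem measurePreserving_swap_resampleConfig (ρ : ℝ) (Q : Set (Space d)) :
    MeasurePreserving Prod.swap (resampleConfig ρ Q U) (resampleConfig ρ Q U) := by
  refine ⟨measurable_swap, Measure.ext_of_lintegral _ fun F hF => ?_⟩
  refine (lintegral_map hF measurable_swap).trans <|
    (lintegral_resampleConfig ρ Q U (hF.comp measurable_swap)).trans <|
    .trans (tsum_congr fun N => congrArg _ ?_) (lintegral_resampleConfig ρ Q U hF).symm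
  have hswap := measurePreserving_pi _ _ fun _ : Fin N =>
    measurePreserving_swap_resampleIn (volume.restrict U) Q
  exact hswap.lintegral_comp (hF.comp measurable_ofPoints_pair)

theorem IsPoisson.identDistrib_fst {P : Measure (Config d)} (hP : IsPoisson ρ P)
    (hQ : MeasurableSet Q) (hU : MeasurableSet U) (hb : Bornology.IsBounded U) {β : Type*}
    [MeasurableSpace β] {φ : Config d → β} (hφ : Measurable[sigmaAlg U] φ) :
    IdentDistrib φ (fun q => φ q.1) P (resampleConfig ρ Q U) := by
  have hφm := measurable_of_sigmaAlg hφ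
  refine identDistrib_of_lintegral_eq hφm (hφm.comp measurable_fst) fun F hF => ?_
  refine (hP U hU hb _ (hF.comp hφ)).trans <| .trans (tsum_congr fun N => congrArg _ ?_)
    (lintegral_resampleConfig ρ Q U (hF.comp (hφm.comp measurable_fst))).symm
  rw [← map_fst_comp_pi_resampleIn hQ N]
  exact lintegral_map (hF.comp (hφm.comp measurable_ofPoints))
    (measurable_pi_lambda _ fun i => measurable_fst.comp (measurable_pi_apply i))

theorem IsPoisson.identDistrib_snd {P : Measure (Config d)} (hP : IsPoisson ρ P)
    (hQ : MeasurableSet Q) (hU : MeasurableSet U) (hb : Bornology.IsBounded U) {β : Type*}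
    [MeasurableSpace β] {φ : Config d → β} (hφ : Measurable[sigmaAlg U] φ) :
    IdentDistrib φ (fun q => φ q.2) P (resampleConfig ρ Q U) := by
  have hφm := measurable_of_sigmaAlg hφ
  have hfst := hP.identDistrib_fst hQ hU hb hφ
  refine ⟨hfst.1, (hφm.comp measurable_snd).aemeasurable, hfst.map_eq.trans ?_⟩
  conv_lhs => rw [← (measurePreserving_swap_resampleConfig ρ Q).map_eq]
  exact Measure.map_map (hφm.comp measurable_fst) measurable_swap

theorem lintegral_pi_resampleIn_sub_sq_le {m : ℝ} (hU : cube d m ⊆ U) {f : Config d → ℝ}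
    (hf : IsSmoothLocal f) (N : ℕ) :
    ∫⁻ z, ‖f (ofPoints (Prod.fst ∘ z)) - f (ofPoints (Prod.snd ∘ z))‖ₑ ^ 2
        ∂(Measure.pi fun _ : Fin N => resampleIn (volume.restrict U) (cube d m)) ≤
      ENNReal.ofReal m ^ 2 * ∫⁻ z, gradEnergy (cube d m) f (ofPoints (Prod.fst ∘ z))
        ∂(Measure.pi fun _ : Fin N => resampleIn (volume.restrict U) (cube d m)) := by
  have hQ := measurableSet_cube d m
  let e (i : Fin N) (x : Fin N → Space d) : ℝ≥0∞ :=
    ENNReal.ofReal m ^ 2 * (cube d m).indicator (fun y => ‖grad f (ofPoints x) y‖ₑ ^ 2) (x i)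
  have he (i : Fin N) : Measurable (e i) := by
    have h : Measurable fun x : Fin N → Space d => ‖grad f (ofPoints x) (x i)‖ₑ ^ 2 :=
      (hf.measurable_grad.comp
        (measurable_ofPoints.prodMk (measurable_pi_apply i))).enorm.pow_const 2
    exact (h.indicator (measurable_pi_apply i hQ)).const_mul _
  have hm : ENNReal.ofReal m ^ 2 ≠ ⊤ := by finiteness
  have hone (i : Fin N) (x : Fin N → Space d) :
      ∫⁻ q, ‖f (ofPoints (Function.update x i q.1)) - f (ofPoints (Function.update x i q.2))‖ₑ ^ 2
        ∂resampleIn (volume.restrict U) (cube d m) ≤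
      ∫⁻ q, e i (Function.update x i q.1) ∂resampleIn (volume.restrict U) (cube d m) := by
    have hsmooth : ContDiff ℝ 1 fun y => f (ofPoints (Function.update x i y)) :=
      ((hf.smooth N).of_le (by simp)).comp (contDiff_update 1 x i)
    have hgrad (y : Space d) : e i (Function.update x i y) = ENNReal.ofReal m ^ 2 *
        (cube d m).indicator
          (fun y => ‖gradient (fun y => f (ofPoints (Function.update x i y))) y‖ₑ ^ 2) y := by
      by_cases hy : y ∈ cube d m <;> simp [e, hy, hf.grad_ofPoints_update]
    simpa only [hgrad, lintegral_const_mul' _ _ hm] using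
      poincare_resampleIn (volume.restrict U) (Measure.restrict_restrict_of_subset hU) hsmooth
  refine (lintegral_enorm_sub_sq_pi_le
    (fun _ => measurePreserving_swap_resampleIn (volume.restrict U) (cube d m))
    (hf.measurable.comp measurable_ofPoints) he hone).trans_eq ?_
  simp only [e, ← Finset.mul_sum, lintegral_const_mul' _ _ hm, hf.gradEnergy_ofPoints hQ,
    Function.comp_apply]

theorem lintegral_resampleConfig_sub_sq_le {m : ℝ} (hU : cube d m ⊆ U) {f : Config d → ℝ}
    (hf : IsSmoothLocal f) :
    ∫⁻ q, ‖f q.1 - f q.2‖ₑ ^ 2 ∂resampleConfig ρ (cube d m) U ≤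
      ENNReal.ofReal m ^ 2 * ∫⁻ q, gradEnergy (cube d m) f q.1 ∂resampleConfig ρ (cube d m) U := by
  have hgrad : Measurable (gradEnergy (cube d m) f) :=
    hf.measurable_gradEnergy (measurableSet_cube d m) .univ (Set.subset_univ _) hf.measurable
  have hsub : Measurable fun q : Config d × Config d => ‖f q.1 - f q.2‖ₑ ^ 2 :=
    ((hf.measurable.comp measurable_fst).sub (hf.measurable.comp measurable_snd)).enorm.pow_const 2
  rw [lintegral_resampleConfig _ _ _ hsub,
    lintegral_resampleConfig _ _ _ (F := fun q => gradEnergy (cube d m) f q.1)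
      (hgrad.comp measurable_fst), ← ENNReal.tsum_mul_left]
  refine ENNReal.tsum_le_tsum fun N => ?_
  rw [mul_left_comm]
  exact mul_le_mul_right (lintegral_pi_resampleIn_sub_sq_le hU hf N) _

end PoissonCoupling

section Translation

variable {V Q U : Set (Space d)} {u : Config d → ℝ}

theorem apply_ofPoints_collapse (hu : Measurable[sigmaAlg V] u) {p : Space d} (hp : p ∉ V) {N : ℕ}
    (x : Fin N → Space d) : u (ofPoints fun i => collapse V p (x i)) = u (ofPoints x) := by
  refine eq_of_measurable_sigmaAlg hu fun B hB hBV => ?_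
  rw [ofPoints_apply _ hB, ofPoints_apply _ hB]
  refine Finset.sum_congr rfl fun i _ => ?_
  by_cases h : x i ∈ V
  · rw [collapse_of_mem h]
  · rw [collapse_of_notMem h, Set.indicator_of_notMem fun h' => h (hBV h'),
      Set.indicator_of_notMem fun h' => hp (hBV h')]

theorem translateFun_zero (u : Config d → ℝ) : translateFun 0 u = u := by
  funext μ
  rw [translateFun, neg_zero, translate_zero]

theorem measurable_translateFun (hu : Measurable u) (h : Space d) : Measurable (translateFun h u) :=
  hu.comp (measurable_translate (-h))

theorem translateFun_ofPoints (u : Config d → ℝ) (h : Space d) {N : ℕ} (x : Fin N → Space d) :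
    translateFun h u (ofPoints x) = u (ofPoints fun i => x i - h) := by
  simp only [translateFun, translate_ofPoints, sub_eq_add_neg]

theorem map_collapse_sub_pi_resampleIn [IsFiniteMeasure (volume.restrict U)]
    (hV : MeasurableSet V) (hVb : Bornology.IsBounded V) (hQ : MeasurableSet Q) (hVQ : V ⊆ Q)
    (hQU : Q ⊆ U) {h : Space d} (hhV : ∀ x, x - h ∈ V → x ∈ Q) (p : Space d) (N : ℕ) :
    (Measure.pi fun _ : Fin N => resampleIn (volume.restrict U) Q).map
        (fun z i => (collapse V p ((z i).1 - h), (z i).2)) =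
      (Measure.pi fun _ : Fin N => resampleIn (volume.restrict U) Q).map
        fun z i => (collapse V p (z i).1, (z i).2) := by
  let π := resampleIn (volume.restrict U) Q
  have hcollapse : Measurable (collapse V p) := measurable_collapse hV p
  have hsub : Measurable fun x => collapse V p (x - h) := hcollapse.comp (measurable_sub_const h)
  have hmap : π.map (Prod.map (fun x => collapse V p (x - h)) id) =
      π.map (Prod.map (collapse V p) id) := by
    refine resampleIn_map_eq _ hQ hsub hcollapse (fun x hx => ?_) ?_
    · rw [collapse_of_notMem fun hx' => hx (hhV x hx'), collapse_of_notMem fun hx' => hx (hVQ hx')]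
    · rw [Measure.restrict_restrict_of_subset hQU]
      exact map_restrict_collapse_sub volume hV hQ hVb.measure_lt_top.ne hVQ hhV p
  refine (Measure.pi_map_pi fun _ => (hsub.prodMap measurable_id).aemeasurable).trans ?_
  rw [hmap]
  exact (Measure.pi_map_pi fun _ => (hcollapse.prodMap measurable_id).aemeasurable).symm

theorem identDistrib_resampleConfig_translateFun (ρ : ℝ) [IsFiniteMeasure (volume.restrict U)]
    (hV : MeasurableSet V) (hVb : Bornology.IsBounded V) (hQ : MeasurableSet Q) (hVQ : V ⊆ Q)
    (hQU : Q ⊆ U) (hu : Measurable[sigmaAlg V] u) {h : Space d} (hhV : ∀ x, x - h ∈ V → x ∈ Q) :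
    IdentDistrib (fun q => (translateFun h u q.1, q.2)) (fun q => (u q.1, q.2))
      (resampleConfig ρ Q U) (resampleConfig ρ Q U) := by
  have hum := measurable_of_sigmaAlg hu
  have hmeas {v : Config d → ℝ} (hv : Measurable v) :
      Measurable fun q : Config d × Config d => (v q.1, q.2) := by fun_prop
  have hum' := measurable_translateFun hum h
  rcases eq_or_ne h 0 with rfl | hh
  · rw [translateFun_zero]
    exact .refl (hmeas hum).aemeasurable
  -- Collapsing the complement of `V` to one point `p ∉ V` does not change `u`, and after it a
  -- uniform particle in `Q` and its translate by `-h` have the same law.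
  obtain ⟨p, hp⟩ : ∃ p, p ∉ V := by
    have : Nontrivial (Space d) := ⟨h, 0, hh⟩
    by_contra! hall
    exact NormedSpace.unbounded_univ ℝ (Space d) (Set.eq_univ_of_forall hall ▸ hVb)
  refine identDistrib_of_lintegral_eq (hmeas hum') (hmeas hum) fun F hF => ?_
  refine (lintegral_resampleConfig ρ Q U (hF.comp (hmeas hum'))).trans <|
    .trans (tsum_congr fun N => congrArg _ ?_)
      (lintegral_resampleConfig ρ Q U (hF.comp (hmeas hum))).symm
  let Φ (z : Fin N → Space d × Space d) : ℝ≥0∞ :=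
    F (u (ofPoints fun i => (z i).1), ofPoints fun i => (z i).2)
  have hΦ : Measurable Φ := (hF.comp (hmeas hum)).comp measurable_ofPoints_pair
  have hcollapse : Measurable (collapse V p) := measurable_collapse hV p
  calc _ = ∫⁻ z, Φ fun i => (collapse V p ((z i).1 - h), (z i).2)
          ∂(Measure.pi fun _ : Fin N => resampleIn (volume.restrict U) Q) := by
        simp only [Φ, apply_ofPoints_collapse hu hp fun _ => (_ : Space d × Space d).1 - h,
          Function.comp_def, translateFun_ofPoints]
    _ = ∫⁻ z, Φ fun i => (collapse V p (z i).1, (z i).2)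
          ∂(Measure.pi fun _ : Fin N => resampleIn (volume.restrict U) Q) := by
        rw [← lintegral_map hΦ (by fun_prop),
          map_collapse_sub_pi_resampleIn hV hVb hQ hVQ hQU hhV, lintegral_map hΦ (by fun_prop)]
    _ = _ := by
        simp only [Φ, apply_ofPoints_collapse hu hp, Function.comp_def]

theorem mem_cube_of_sub_mem {l k : ℝ} {h : Space d} (hh : ‖h‖ ≤ k) {x : Space d}
    (hx : x - h ∈ cube d l) : x ∈ cube d (l + 2 * k) := by
  intro i
  have hhi := abs_le.1 ((PiLp.norm_apply_le h i).trans hh)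
  have hxi := hx i
  rw [PiLp.sub_apply, Set.mem_Icc] at hxi
  exact ⟨by linarith, by linarith⟩

end Translation

section Campbell

theorem eLpNorm_two_sq {α E : Type*} [MeasurableSpace α] [NormedAddCommGroup E] (f : α → E)
    (μ : Measure α) : eLpNorm f 2 μ ^ 2 = ∫⁻ a, ‖f a‖ₑ ^ 2 ∂μ := by
  simpa using eLpNorm_nnreal_pow_eq_lintegral (μ := μ) (f := f) (two_ne_zero : (2 : ℝ≥0) ≠ 0)

/-- The Campbell measure `dμ(x) dP(μ)`, with respect to which the gradients are square
integrable. -/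
noncomputable def campbell (P : Measure (Config d)) : Measure (Config d × Space d) :=
  P ⊗ₘ particleKernel d

theorem energyOn_eq_eLpNorm_sq (P : Measure (Config d)) [SFinite P] {U : Set (Space d)}
    (hU : MeasurableSet U) {G : Config d → Space d → Space d}
    (hG : Measurable (Function.uncurry G)) :
    energyOn P U G =
      eLpNorm (Function.uncurry G) 2 ((campbell P).restrict (Set.univ ×ˢ U)) ^ 2 := by
  rw [eLpNorm_two_sq, campbell, Measure.setLIntegral_compProd (hG.enorm.pow_const 2) .univ hU,
    Measure.restrict_univ]
  rfl

theorem energyOn_univ_eq_eLpNorm_sq (P : Measure (Config d)) [SFinite P]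
    {G : Config d → Space d → Space d} (hG : Measurable (Function.uncurry G)) :
    energyOn P Set.univ G = eLpNorm (Function.uncurry G) 2 (campbell P) ^ 2 := by
  rw [energyOn_eq_eLpNorm_sq P .univ hG, Set.univ_prod_univ, Measure.restrict_univ]

variable {P : Measure (Config d)} {F : Config d → ℝ} {G : Config d → Space d → Space d}

theorem HasH10Gradient.exists_tendsto [SFinite P] (hF : HasH10Gradient P F G) :
    ∃ φ : ℕ → Config d → ℝ, (∀ n, IsSmoothLocal (φ n)) ∧ (∀ n, MemLp (φ n) 2 P) ∧
      (∀ n, MemLp (Function.uncurry (grad (φ n))) 2 (campbell P)) ∧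
      Tendsto (fun n => eLpNorm (φ n - F) 2 P) atTop (𝓝 0) ∧
      Tendsto (fun n => eLpNorm (Function.uncurry (grad (φ n)) - Function.uncurry G) 2 (campbell P))
        atTop (𝓝 0) := by
  obtain ⟨φ, hφ, hlim, hgradlim⟩ := hF.approx
  have hmeas n : Measurable (Function.uncurry (grad (φ n))) := (hφ n).1.measurable_grad
  refine ⟨φ, fun n => (hφ n).1, fun n => (hφ n).2.1,
    fun n => ⟨(hmeas n).aestronglyMeasurable, ?_⟩, hlim, ?_⟩
  · have h := (hφ n).2.2
    rwa [energyOn_univ_eq_eLpNorm_sq P (hmeas n), ENNReal.pow_lt_top_iff, or_iff_left two_ne_zero]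
      at h
  · have h (n) : energyOn P Set.univ (fun μ x => grad (φ n) μ x - G μ x) =
        eLpNorm (Function.uncurry (grad (φ n)) - Function.uncurry G) 2 (campbell P) ^ 2 :=
      energyOn_univ_eq_eLpNorm_sq P ((hmeas n).sub hF.measurable_grad)
    simp only [h] at hgradlim
    have hroot (a : ℝ≥0∞) : (a ^ 2) ^ (2⁻¹ : ℝ) = a := by
      rw [← ENNReal.rpow_natCast_mul]
      norm_num
    have hsqrt := hgradlim.ennrpow_const (2⁻¹ : ℝ)
    simpa only [hroot, ENNReal.zero_rpow_of_pos (inv_pos.2 (zero_lt_two' ℝ))] using hsqrt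

theorem HasH10Gradient.memLp_grad [SFinite P] (hF : HasH10Gradient P F G) :
    MemLp (Function.uncurry G) 2 (campbell P) := by
  obtain ⟨φ, -, -, hφ, -, hlim⟩ := hF.exists_tendsto
  obtain ⟨n, hn⟩ := (hlim.eventually_lt_const ENNReal.zero_lt_top).exists
  have hmeas : AEStronglyMeasurable (Function.uncurry G) (campbell P) :=
    Measurable.aestronglyMeasurable hF.measurable_grad
  simpa using (hφ n).sub ⟨(hφ n).1.sub hmeas, hn⟩

end Campbell

section PerturbationEstimate

theorem eLpNorm_sq_sub_sq_mul_le {α : Type*} [MeasurableSpace α] {μ : Measure α} {f g w : α → ℝ}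
    (hf : AEStronglyMeasurable f μ) (hg : AEStronglyMeasurable g μ)
    (hw : AEStronglyMeasurable w μ) :
    eLpNorm ((f ^ 2 - g ^ 2) * w) 1 μ ≤
      eLpNorm w ⊤ μ * (eLpNorm (f - g) 2 μ * (eLpNorm f 2 μ + eLpNorm g 2 μ)) := by
  have hfactor : (f ^ 2 - g ^ 2) * w = w • ((f - g) • (f + g)) := by
    simp only [smul_eq_mul]
    ring
  rw [hfactor]
  calc _ ≤ eLpNorm w ⊤ μ * eLpNorm ((f - g) • (f + g)) 1 μ :=
        eLpNorm_smul_le_mul_eLpNorm ((hf.sub hg).smul (hf.add hg)) hw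
    _ ≤ eLpNorm w ⊤ μ * (eLpNorm (f - g) 2 μ * eLpNorm (f + g) 2 μ) := by
        gcongr
        exact eLpNorm_smul_le_mul_eLpNorm (hf.add hg) (hf.sub hg)
    _ ≤ _ := by
        gcongr
        exact eLpNorm_add_le hf hg one_le_two

theorem enorm_integral_sq_sub_sq_mul_le {α : Type*} [MeasurableSpace α] {μ : Measure α}
    {f g w : α → ℝ} (hf : AEStronglyMeasurable f μ) (hg : AEStronglyMeasurable g μ)
    (hw : AEStronglyMeasurable w μ) :
    ‖∫ a, (f a ^ 2 - g a ^ 2) * w a ∂μ‖ₑ ≤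
      eLpNorm w ⊤ μ * (eLpNorm (f - g) 2 μ * (eLpNorm f 2 μ + eLpNorm g 2 μ)) :=
  (enorm_integral_le_lintegral_enorm _).trans
    (eLpNorm_one_eq_lintegral_enorm.symm.trans_le (eLpNorm_sq_sub_sq_mul_le hf hg hw))

theorem tendsto_eLpNorm_of_tendsto_eLpNorm_sub {α E ι : Type*} [MeasurableSpace α]
    [NormedAddCommGroup E] {μ : Measure α} {p : ℝ≥0∞} (hp : 1 ≤ p) {l : Filter ι} {φ : ι → α → E}
    {f : α → E} (hφ : ∀ i, AEStronglyMeasurable (φ i) μ) (hf : AEStronglyMeasurable f μ)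
    (hlim : Tendsto (fun i => eLpNorm (φ i - f) p μ) l (𝓝 0)) :
    Tendsto (fun i => eLpNorm (φ i) p μ) l (𝓝 (eLpNorm f p μ)) := by
  have hlower := ENNReal.Tendsto.sub (tendsto_const_nhds (x := eLpNorm f p μ)) hlim
    (Or.inr ENNReal.zero_ne_top)
  have hupper := (tendsto_const_nhds (x := eLpNorm f p μ)).add hlim
  rw [tsub_zero] at hlower
  rw [add_zero] at hupper
  refine tendsto_of_tendsto_of_tendsto_of_le_of_le hlower hupper (fun i => ?_) fun i => ?_
  · rw [tsub_le_iff_right, eLpNorm_sub_comm]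
    simpa using eLpNorm_add_le (hφ i) (hf.sub (hφ i)) hp
  · simpa using eLpNorm_add_le hf ((hφ i).sub hf) hp

theorem tendsto_integral_sq_mul {α ι : Type*} [MeasurableSpace α] {μ : Measure α} {l : Filter ι}
    {φ : ι → α → ℝ} {f w : α → ℝ} (hφ : ∀ i, MemLp (φ i) 2 μ) (hf : MemLp f 2 μ)
    (hw : MemLp w ⊤ μ) (hlim : Tendsto (fun i => eLpNorm (φ i - f) 2 μ) l (𝓝 0)) :
    Tendsto (fun i => ∫ a, φ i a ^ 2 * w a ∂μ) l (𝓝 (∫ a, f a ^ 2 * w a ∂μ)) := by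
  have hbound (i) : edist (∫ a, φ i a ^ 2 * w a ∂μ) (∫ a, f a ^ 2 * w a ∂μ) ≤
      eLpNorm w ⊤ μ * (eLpNorm (φ i - f) 2 μ * (eLpNorm (φ i) 2 μ + eLpNorm f 2 μ)) := by
    have hsub := integral_sub ((hφ i).integrable_sq.mul_of_top_left hw)
      (hf.integrable_sq.mul_of_top_left hw)
    refine (edist_eq_enorm_sub _ _).trans_le ((congrArg enorm hsub.symm).trans_le ?_)
    simpa only [Pi.mul_apply, sub_mul] using
      enorm_integral_sq_sub_sq_mul_le (hφ i).1 hf.1 hw.1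
  have hnorm := tendsto_eLpNorm_of_tendsto_eLpNorm_sub one_le_two (fun i => (hφ i).1) hf.1 hlim
  have hlimit := ENNReal.Tendsto.const_mul (a := eLpNorm w ⊤ μ) (ENNReal.Tendsto.mul hlim
    (.inr (ENNReal.add_ne_top.2 ⟨hf.2.ne, hf.2.ne⟩)) (hnorm.add_const _)
    (.inr ENNReal.zero_ne_top)) (.inr hw.2.ne)
  rw [zero_mul, mul_zero] at hlimit
  exact tendsto_iff_edist_tendsto_0.2 <|
    tendsto_of_tendsto_of_tendsto_of_le_of_le tendsto_const_nhds hlimit (fun _ => zero_le) hbound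

theorem measurable_translateFun_sigmaAlg {V Q : Set (Space d)} {u : Config d → ℝ}
    (hu : Measurable[sigmaAlg V] u) {h : Space d} (hhV : ∀ x, x - h ∈ V → x ∈ Q) :
    Measurable[sigmaAlg Q] (translateFun h u) := by
  refine hu.comp (measurable_sigmaAlg_of_apply fun B hB hBV => ?_)
  simp only [translate_apply (-h) _ hB]
  exact measurable_apply (measurable_add_const (-h) hB) fun x hx =>
    hhV x (hBV (by simpa [sub_eq_add_neg] using hx))

variable {ρ : ℝ} {P : Measure (Config d)} {V : Set (Space d)} {u f : Config d → ℝ} {h : Space d}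
  {m : ℝ}

theorem IsPoisson.identDistrib_translateFun (hP : IsPoisson ρ P) (hV : MeasurableSet V)
    (hVQ : V ⊆ cube d m) (hhV : ∀ x, x - h ∈ V → x ∈ cube d m) (hu : Measurable[sigmaAlg V] u) :
    IdentDistrib (translateFun h u) u P P := by
  have hQ := measurableSet_cube d m
  have hb := (isCompact_cube d m).isBounded
  have : IsFiniteMeasure (volume.restrict (cube d m)) :=
    isFiniteMeasure_restrict.2 hb.measure_lt_top.ne
  have hcoupled :=
    identDistrib_resampleConfig_translateFun ρ hV (hb.subset hVQ) hQ hVQ subset_rfl hu hhV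
  exact (hP.identDistrib_fst hQ hQ hb (measurable_translateFun_sigmaAlg hu hhV)).trans <|
    (hcoupled.comp measurable_fst).trans
      (hP.identDistrib_fst hQ hQ hb (hu.mono (sigmaAlg_mono hVQ) le_rfl)).symm

theorem IsPoisson.memLp_top_sub_translateFun (hP : IsPoisson ρ P) (hV : MeasurableSet V)
    (hVQ : V ⊆ cube d m) (hhV : ∀ x, x - h ∈ V → x ∈ cube d m) (hu : Measurable[sigmaAlg V] u)
    (hutop : MemLp u ⊤ P) : MemLp (u - translateFun h u) ⊤ P :=
  hutop.sub ((hP.identDistrib_translateFun hV hVQ hhV hu).memLp_iff.2 hutop)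

theorem IsPoisson.eLpNorm_top_sub_translateFun_le (hP : IsPoisson ρ P) (hV : MeasurableSet V)
    (hVQ : V ⊆ cube d m) (hhV : ∀ x, x - h ∈ V → x ∈ cube d m) (hu : Measurable[sigmaAlg V] u) :
    eLpNorm (u - translateFun h u) ⊤ P ≤ 2 * eLpNorm u ⊤ P := by
  have hum := measurable_of_sigmaAlg hu
  refine (eLpNorm_sub_le hum.aestronglyMeasurable
    (measurable_translateFun hum h).aestronglyMeasurable le_top).trans_eq ?_
  rw [(hP.identDistrib_translateFun hV hVQ hhV hu).eLpNorm_eq, two_mul]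

theorem integral_resampleConfig_sq_snd_mul_eq_zero {Q U : Set (Space d)}
    [IsFiniteMeasure (volume.restrict U)] (hV : MeasurableSet V) (hVb : Bornology.IsBounded V)
    (hQ : MeasurableSet Q) (hVQ : V ⊆ Q) (hQU : Q ⊆ U) (hhV : ∀ x, x - h ∈ V → x ∈ Q)
    (hu : Measurable[sigmaAlg V] u)
    (hutop : MemLp (fun q => u q.1) ⊤ (resampleConfig ρ Q U)) (hf : Measurable f)
    (hf2 : MemLp (fun q => f q.2) 2 (resampleConfig ρ Q U)) :
    ∫ q, f q.2 ^ 2 * (u q.1 - translateFun h u q.1) ∂resampleConfig ρ Q U = 0 := by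
  have hcoupled : IdentDistrib (fun q => f q.2 ^ 2 * translateFun h u q.1)
      (fun q => f q.2 ^ 2 * u q.1) (resampleConfig ρ Q U) (resampleConfig ρ Q U) :=
    (identDistrib_resampleConfig_translateFun ρ hV hVb hQ hVQ hQU hu hhV).comp
      (u := fun p : ℝ × Config d => f p.2 ^ 2 * p.1) (by fun_prop)
  have hint : Integrable (fun q => f q.2 ^ 2 * u q.1) (resampleConfig ρ Q U) :=
    hf2.integrable_sq.mul_of_top_left hutop
  simp only [mul_sub]
  rw [integral_sub hint (hcoupled.integrable_iff.2 hint), hcoupled.integral_eq, sub_self]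

theorem IsPoisson.eLpNorm_sub_resampleConfig_le (hP : IsPoisson ρ P) {U : Set (Space d)}
    (hU : MeasurableSet U) (hb : Bornology.IsBounded U) (hQU : cube d m ⊆ U)
    (hf : IsSmoothLocal f) (hfU : Measurable[sigmaAlg U] f) :
    eLpNorm (fun q => f q.1 - f q.2) 2 (resampleConfig ρ (cube d m) U) ≤ ENNReal.ofReal m *
      eLpNorm (Function.uncurry (grad f)) 2 ((campbell P).restrict (Set.univ ×ˢ cube d m)) := by
  have hQ := measurableSet_cube d m
  have := hP.isProbabilityMeasure
  have : IsFiniteMeasure (volume.restrict U) := isFiniteMeasure_restrict.2 hb.measure_lt_top.ne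
  have henergy :=
    (hP.identDistrib_fst hQ hU hb (hf.measurable_gradEnergy hQ hU hQU hfU)).lintegral_eq
  rw [← ENNReal.pow_le_pow_left_iff two_ne_zero, mul_pow, eLpNorm_two_sq,
    ← energyOn_eq_eLpNorm_sq P hQ (G := grad f) hf.measurable_grad]
  exact (lintegral_resampleConfig_sub_sq_le hQU hf).trans_eq (congrArg _ henergy.symm)

theorem IsPoisson.integral_sq_mul_sub_translateFun (hP : IsPoisson ρ P) {Q U : Set (Space d)}
    (hV : MeasurableSet V) (hQ : MeasurableSet Q) (hU : MeasurableSet U)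
    (hUb : Bornology.IsBounded U) (hVQ : V ⊆ Q) (hQU : Q ⊆ U) (hhV : ∀ x, x - h ∈ V → x ∈ Q)
    (hu : Measurable[sigmaAlg V] u) (hutop : MemLp u ⊤ P) (hf : Measurable[sigmaAlg U] f)
    (hf2 : MemLp f 2 P) :
    ∫ μ, f μ ^ 2 * (u μ - translateFun h u μ) ∂P =
      ∫ q, (f q.1 ^ 2 - f q.2 ^ 2) * (u q.1 - translateFun h u q.1) ∂resampleConfig ρ Q U := by
  have : IsFiniteMeasure (volume.restrict U) := isFiniteMeasure_restrict.2 hUb.measure_lt_top.ne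
  have huU := hu.mono (sigmaAlg_mono (hVQ.trans hQU)) le_rfl
  have hτU := (measurable_translateFun_sigmaAlg hu hhV).mono (sigmaAlg_mono hQU) le_rfl
  have hVb := hUb.subset (hVQ.trans hQU)
  have hfst := (hP.identDistrib_fst hQ hU hUb hf).memLp_iff.1 hf2
  have hsnd := (hP.identDistrib_snd hQ hU hUb hf).memLp_iff.1 hf2
  have hu1 := (hP.identDistrib_fst hQ hU hUb huU).memLp_iff.1 hutop
  have hτ1 : MemLp (fun q => translateFun h u q.1) ⊤ (resampleConfig ρ Q U) :=
    ((identDistrib_resampleConfig_translateFun ρ hV hVb hQ hVQ hQU hu hhV).comp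
      measurable_fst).memLp_iff.2 hu1
  have hzero := integral_resampleConfig_sq_snd_mul_eq_zero hV hVb hQ hVQ hQU hhV hu hu1
    (measurable_of_sigmaAlg hf) hsnd
  refine (IdentDistrib.integral_eq (hP.identDistrib_fst hQ hU hUb
    (φ := fun μ => f μ ^ 2 * (u μ - translateFun h u μ))
    ((hf.pow_const 2).mul (huU.sub hτU)))).trans ?_
  simp only [sub_mul]
  refine .trans ?_ (integral_sub (hfst.integrable_sq.mul_of_top_left (hu1.sub hτ1))
    (hsnd.integrable_sq.mul_of_top_left (hu1.sub hτ1))).symm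
  exact ((congrArg _ hzero).trans (sub_zero _)).symm

theorem IsPoisson.enorm_integral_sq_mul_sub_translateFun_le_of_isSmoothLocal (hP : IsPoisson ρ P)
    (hV : MeasurableSet V) (hVQ : V ⊆ cube d m) (hhV : ∀ x, x - h ∈ V → x ∈ cube d m)
    (hu : Measurable[sigmaAlg V] u) (hutop : MemLp u ⊤ P) (hf : IsSmoothLocal f) :
    ‖∫ μ, f μ ^ 2 * (u μ - translateFun h u μ) ∂P‖ₑ ≤
      4 * ENNReal.ofReal m * eLpNorm u ⊤ P * (eLpNorm f 2 P * eLpNorm (Function.uncurry (grad f)) 2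
        ((campbell P).restrict (Set.univ ×ˢ cube d m))) := by
  have := hP.isProbabilityMeasure
  have hQ := measurableSet_cube d m
  have hQb := (isCompact_cube d m).isBounded
  obtain ⟨K, hK, hfK⟩ := hf.local_meas
  obtain ⟨B, hB⟩ := hf.bounded
  let U := K ∪ cube d m
  have hU : MeasurableSet U := hK.measurableSet.union hQ
  have hUb : Bornology.IsBounded U := hK.isBounded.union hQb
  have : IsFiniteMeasure (volume.restrict U) := isFiniteMeasure_restrict.2 hUb.measure_lt_top.ne
  have hQU : cube d m ⊆ U := Set.subset_union_right
  have hfU : Measurable[sigmaAlg U] f := hfK.mono (sigmaAlg_mono Set.subset_union_left) le_rfl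
  have huU : Measurable[sigmaAlg U] u := hu.mono (sigmaAlg_mono (hVQ.trans hQU)) le_rfl
  have hwU : Measurable[sigmaAlg U] (u - translateFun h u) :=
    huU.sub ((measurable_translateFun_sigmaAlg hu hhV).mono (sigmaAlg_mono hQU) le_rfl)
  have hf2 : MemLp f 2 P :=
    .of_bound hf.measurable.aestronglyMeasurable B (ae_of_all _ fun μ => hB μ)
  have hfst := hP.identDistrib_fst hQ hU hUb hfU
  have hsnd := hP.identDistrib_snd hQ hU hUb hfU
  have hw := hP.identDistrib_fst hQ hU hUb hwU
  rw [hP.integral_sq_mul_sub_translateFun hV hQ hU hUb hVQ hQU hhV hu hutop hfU hf2]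
  refine (enorm_integral_sq_sub_sq_mul_le hfst.aemeasurable_snd.aestronglyMeasurable
    hsnd.aemeasurable_snd.aestronglyMeasurable hw.aemeasurable_snd.aestronglyMeasurable).trans ?_
  rw [← hfst.eLpNorm_eq, ← hsnd.eLpNorm_eq, ← hw.eLpNorm_eq]
  calc _ ≤ 2 * eLpNorm u ⊤ P * (ENNReal.ofReal m * eLpNorm (Function.uncurry (grad f)) 2
        ((campbell P).restrict (Set.univ ×ˢ cube d m)) * (eLpNorm f 2 P + eLpNorm f 2 P)) := by
        gcongr
        · exact hP.eLpNorm_top_sub_translateFun_le hV hVQ hhV hu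
        · exact hP.eLpNorm_sub_resampleConfig_le hU hUb hQU hf hfU
    _ = _ := by ring

variable {F : Config d → ℝ} {G : Config d → Space d → Space d}

theorem IsPoisson.enorm_integral_sq_mul_sub_translateFun_le (hP : IsPoisson ρ P)
    (hV : MeasurableSet V) (hVQ : V ⊆ cube d m) (hhV : ∀ x, x - h ∈ V → x ∈ cube d m)
    (hu : Measurable[sigmaAlg V] u) (hutop : MemLp u ⊤ P) (hF : HasH10Gradient P F G) :
    ‖∫ μ, F μ ^ 2 * (u μ - translateFun h u μ) ∂P‖ₑ ≤
      4 * ENNReal.ofReal m * eLpNorm u ⊤ P * (eLpNorm F 2 P * eLpNorm (Function.uncurry G) 2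
        ((campbell P).restrict (Set.univ ×ˢ cube d m))) := by
  have := hP.isProbabilityMeasure
  obtain ⟨φ, hφ, hφ2, hgrad, hlim, hgradlim⟩ := hF.exists_tendsto
  set ν := (campbell P).restrict (Set.univ ×ˢ cube d m)
  have hG : MemLp (Function.uncurry G) 2 ν := hF.memLp_grad.restrict _
  have hgradlim' : Tendsto
      (fun n => eLpNorm (Function.uncurry (grad (φ n)) - Function.uncurry G) 2 ν) atTop (𝓝 0) :=
    tendsto_of_tendsto_of_tendsto_of_le_of_le tendsto_const_nhds hgradlim (fun _ => zero_le)
      fun _ => eLpNorm_mono_measure _ Measure.restrict_le_self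
  have hφnorm := tendsto_eLpNorm_of_tendsto_eLpNorm_sub one_le_two (fun n => (hφ2 n).1)
    hF.memLp.1 hlim
  have hgradnorm := tendsto_eLpNorm_of_tendsto_eLpNorm_sub one_le_two
    (fun n => ((hgrad n).restrict _).1) hG.1 hgradlim'
  have hw := hP.memLp_top_sub_translateFun hV hVQ hhV hu hutop
  refine le_of_tendsto_of_tendsto' (tendsto_integral_sq_mul hφ2 hF.memLp hw hlim).enorm
    (ENNReal.Tendsto.const_mul (ENNReal.Tendsto.mul hφnorm (.inr hG.2.ne) hgradnorm
      (.inr hF.memLp.2.ne)) (.inr ?_)) fun n =>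
    hP.enorm_integral_sq_mul_sub_translateFun_le_of_isSmoothLocal hV hVQ hhV hu hutop (hφ n)
  exact ENNReal.mul_ne_top (ENNReal.mul_ne_top ENNReal.ofNat_ne_top ENNReal.ofReal_ne_top)
    hutop.2.ne

end PerturbationEstimate

theorem eLpNorm_two_sqrt_sq {α : Type*} [MeasurableSpace α] {μ : Measure α} {g : α → ℝ}
    (hg : 0 ≤ᵐ[μ] g) (hint : Integrable g μ) :
    eLpNorm (fun a => √(g a)) 2 μ ^ 2 = ENNReal.ofReal (∫ a, g a ∂μ) := by
  rw [eLpNorm_two_sq, ofReal_integral_eq_lintegral_ofReal hint hg]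
  refine lintegral_congr_ae (hg.mono fun a ha => ?_)
  simp only [Real.enorm_of_nonneg (Real.sqrt_nonneg _), ← ENNReal.ofReal_pow (Real.sqrt_nonneg _),
    Real.sq_sqrt ha]

theorem ofReal_sq_le (x : ℝ) : ENNReal.ofReal x ^ 2 ≤ ENNReal.ofReal (x ^ 2) := by
  rw [← sq_abs, ENNReal.ofReal_pow (abs_nonneg x)]
  gcongr
  exact le_abs_self x

end PoissonConfig

open PoissonConfig in
theorem proposition5p2_general {d : ℕ} {ρ : ℝ} {P : Measure (Config d)} (hP : IsPoisson ρ P)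
    {u : Config d → ℝ} {l : ℝ} (hu : Measurable[sigmaAlg (cube d l)] u) (hutop : MemLp u ⊤ P)
    {k : ℝ} {h : Space d} (hh : ‖h‖ ≤ k) {g : Config d → ℝ} {G : Config d → Space d → Space d}
    (hg : 0 ≤ᵐ[P] g) (hg1 : ∫ μ, g μ ∂P = 1) (hG : HasH10Gradient P (fun μ => √(g μ)) G) :
    Integrable (fun μ => g μ * (u μ - translateFun h u μ)) P ∧
      ENNReal.ofReal ((∫ μ, g μ * (u μ - translateFun h u μ) ∂P) ^ 2) ≤
        ENNReal.ofReal (16 * ((l + 2 * k) * (eLpNorm u ⊤ P).toReal) ^ 2) *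
          energyOn P (cube d (l + 2 * k)) G := by
  have := hP.isProbabilityMeasure
  have hV := measurableSet_cube d l
  have hVQ : cube d l ⊆ cube d (l + 2 * k) := fun x hx =>
    mem_cube_of_sub_mem (norm_zero.trans_le ((norm_nonneg h).trans hh)) (by rwa [sub_zero])
  have hhV (x : Space d) : x - h ∈ cube d l → x ∈ cube d (l + 2 * k) := mem_cube_of_sub_mem hh
  have hint : Integrable g P := .of_integral_ne_zero (by simp [hg1])
  refine ⟨hint.mul_of_top_left (hP.memLp_top_sub_translateFun hV hVQ hhV hu hutop), ?_⟩
  have hnorm : eLpNorm (fun μ => √(g μ)) 2 P ^ 2 = 1 := by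
    rw [eLpNorm_two_sqrt_sq hg hint, hg1, ENNReal.ofReal_one]
  have hsqrt : ∫ μ, √(g μ) ^ 2 * (u μ - translateFun h u μ) ∂P =
      ∫ μ, g μ * (u μ - translateFun h u μ) ∂P :=
    integral_congr_ae (hg.mono fun μ hμ => by simp only [Real.sq_sqrt hμ])
  have hbound := hP.enorm_integral_sq_mul_sub_translateFun_le hV hVQ hhV hu hutop hG
  rw [energyOn_eq_eLpNorm_sq P (measurableSet_cube d _) hG.measurable_grad,
    ← enorm_sq_eq_ofReal, ← hsqrt]
  grw [hbound]
  rw [mul_pow, mul_pow (eLpNorm _ 2 P), hnorm, one_mul]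
  gcongr
  calc (4 * ENNReal.ofReal (l + 2 * k) * eLpNorm u ⊤ P) ^ 2
      = ENNReal.ofReal (4 * ((l + 2 * k) * (eLpNorm u ⊤ P).toReal)) ^ 2 := by
        rw [ENNReal.ofReal_mul zero_le_four, ENNReal.ofReal_mul' ENNReal.toReal_nonneg,
          ENNReal.ofReal_toReal hutop.2.ne, ENNReal.ofReal_ofNat, mul_assoc]
    _ ≤ _ := (ofReal_sq_le _).trans_eq (congrArg _ (by ring))

theorem proposition5p2 (d : ℕ) :
    ∃ C : ℝ, 0 < C ∧
      ∀ (ρ : ℝ) (P : Measure (PoissonConfig.Config d)), 0 < ρ → PoissonConfig.IsPoisson ρ P →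
      ∀ (u : PoissonConfig.Config d → ℝ) (l : ℝ), 0 ≤ l → PoissonConfig.IsSmoothLocal u →
        Measurable[PoissonConfig.sigmaAlg (PoissonConfig.cube d l)] u →
      ∀ (k : ℝ) (h : PoissonConfig.Space d), ‖h‖ ≤ k →
      ∀ (g : PoissonConfig.Config d → ℝ)
        (G : PoissonConfig.Config d → PoissonConfig.Space d → PoissonConfig.Space d),
        0 ≤ᵐ[P] g → ∫ μ, g μ ∂P = 1 →
        PoissonConfig.HasH10Gradient P (fun μ => √(g μ)) G →
        Integrable (fun μ => g μ * (u μ - PoissonConfig.translateFun h u μ)) P ∧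
        ENNReal.ofReal ((∫ μ, g μ * (u μ - PoissonConfig.translateFun h u μ) ∂P) ^ 2) ≤
          ENNReal.ofReal (C * ((l + 2 * k) * (eLpNorm u ⊤ P).toReal) ^ 2) *
            PoissonConfig.energyOn P (PoissonConfig.cube d (l + 2 * k)) G := by
  refine ⟨16, by norm_num, fun ρ P _ hP u l _ hu hul k h hh g G hg hg1 hG => ?_⟩
  obtain ⟨B, hB⟩ := hu.bounded
  exact proposition5p2_general hP hul
    (memLp_top_of_bound hu.measurable.aestronglyMeasurable B (ae_of_all _ hB)) hh hg hg1 hG
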